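/- Let $\theta\in[0,\tfrac{\pi}{4})$, $c_0>0$, $K_0<0$ and $K_1\in\mathbb{R}$. Put $\mathbf d=(\cos\theta,\sin\theta)$, $\mathbf k_1=(1,0)$, $\mathbf k_2=(0,1)$. For $\theta\neq 0$ consider the four-dimensional real reduced system $$\partial_\Xi A_j=B_j,\qquad \partial_\Xi B_j=-\frac{1}{4(\mathbf d\cdot\mathbf k_j)^2}\Bigl(\mu_0A_j+c_0B_j+(K_0|A_j|^2+K_1|A_l|^2)A_j+r_{j}^{\varepsilon}\Bigr),\qquad \{j,l\}=\{1,2\},\tag{1}$$ with $r^\varepsilon=r^\varepsilon(A_1,B_1,A_2,B_2)\in\mathbb R^2$, and for $\theta=0$ the slow subsystem $$\partial_\Xi A_1=B_1,\quad \partial_\Xi B_1=-\tfrac14\bigl(\mu_0A_1+c_0B_1+(K_0|A_1|^2+K_1|A_2|^2)A_1+r_1^\varepsilon\bigr),\quad c_0\,\partial_\Xi A_2=-\mu_0A_2-(K_0|A_2|^2+K_1|A_1|^2)A_2-r_2^\varepsilon\tag{2}$$ with $r^\varepsilon=r^\varepsilon(A_1,B_1,A_2)\in\mathbb R^2$. Here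 $(r^\varepsilon)_{\varepsilon>0}$ are higher-order terms of order $\mathcal O(\varepsilon)$: $r^\varepsilon(0)=0$ for all small $\varepsilon>0$ and, for every $\rho>0$ there is $C_\rho$ such that for all sufficiently small $\varepsilon>0$ the map $r^\varepsilon$ is $C^1$ on the ball of radius $\rho$ around $0$ with $|r^\varepsilon|\le C_\rho\varepsilon$ and $\|Dr^\varepsilon\|\le C_\rho\varepsilon$ there. The leading-order systems are those with $r^\varepsilon$ replaced by $0$. Points with vanishing $B$-components are written $(\mathbf A,\mathbf 0)$, $\mathbf A=(A_1,A_2)$. Let squares be the points $\mathbf A_S$ with $|A_{1}|=|A_{2}|=\sqrt{-\mu_0/(K_0+K_1)}$, roll waves the points $\mathbf A_R=(\pm\sqrt{-\mu_0/K_0},0)$, and $\mathbf A_T=(0,0)$ the trivial state. 1. If $K_1<K_0$, then for every $\mu_0>0$ and every square $\mathbf A_*=\mathbf A_S$, both in (1) (for $\theta\ne0$) and in (2) the following holds. (a) The leading-order system has a heteroclinic orbit, i.e. a solution defined for all $\Xi\in\mathbb R$, with $\lim_{\Xi\to-\infty}(\mathbf A,\mathbf B)=(\mathbf A_*,\mathbf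 0)$ and $\lim_{\Xi\to+\infty}(\mathbf A,\mathbf B)=(\mathbf A_T,\mathbf 0)$. (b) For every family of higher-order terms as above there are $C$ and $\varepsilon_0>0$ such that for all $\varepsilon\in(0,\varepsilon_0)$ the system with $r^\varepsilon$ has an equilibrium $(\mathbf A_*^\varepsilon,\mathbf 0)\neq 0$ with $|\mathbf A_*^\varepsilon-\mathbf A_*|\le C\varepsilon$, and a heteroclinic orbit with limit $(\mathbf A_*^\varepsilon,\mathbf 0)$ as $\Xi\to-\infty$ and $(\mathbf A_T,\mathbf 0)$ as $\Xi\to+\infty$. If $r^\varepsilon$ has the lattice symmetries (changing the sign of $(A_j,B_j)$ changes the sign of $r_j^\varepsilon$ and leaves the other component unchanged, for $j=1,2$; and, at $\mathbf B=\mathbf 0$, exchanging $A_1$ and $A_2$ exchanges $r_1^\varepsilon$ and $r_2^\varepsilon$), then $\mathbf A_*^\varepsilon$ is again a square: $|A_{*,1}^\varepsilon|=|A_{*,2}^\varepsilon|\ne0$. 2. If $K_0<K_1<0$, then for every $\mu_0>0$ and every roll wave $\mathbf A_*=\mathbf A_R$, the statements (a) and (b) hold both in (1) (for $\theta\neq0$)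 and in (2), where in the symmetric case $\mathbf A_*^\varepsilon$ is again a roll wave: $A_{*,1}^\varepsilon\neq0$, $A_{*,2}^\varepsilon=0$. In (2) the $\mathbf B$-component consists of $B_1$ only. -/

import Mathlib

open Filter Topology Set

noncomputable section

namespace SquareLattice

/-- The front direction `d = (cos θ, sin θ)`. -/
def dir (θ : ℝ) : EuclideanSpace ℝ (Fin 2) := !₂[Real.cos θ, Real.sin θ]

/-- The generator `k₁ = (1, 0)` of the square Fourier lattice. -/
def k₁ : EuclideanSpace ℝ (Fin 2) := !₂[1, 0]

/-- The generator `k₂ = (0, 1)` of the square Fourier lattice. -/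
def k₂ : EuclideanSpace ℝ (Fin 2) := !₂[0, 1]

/-- Phase space of the reduced system (`θ ≠ 0`), with coordinates `(A₁, B₁, A₂, B₂)`. -/
abbrev Phase4 := ℝ × ℝ × ℝ × ℝ

/-- Phase space of the slow subsystem (`θ = 0`), with coordinates `(A₁, B₁, A₂)`. -/
abbrev Phase3 := ℝ × ℝ × ℝ

/-- The point `(𝐀, 𝟎)` of the four-dimensional phase space. -/
def embed4 (A : ℝ × ℝ) : Phase4 := (A.1, 0, A.2, 0)

/-- The point `(𝐀, 𝟎)` of the three-dimensional phase space. -/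
def embed3 (A : ℝ × ℝ) : Phase3 := (A.1, 0, A.2)

/-- Right-hand side of the four-dimensional reduced system
`A_j' = B_j`,
`4 (d·k_j)² B_j' = - μ₀ A_j - c₀ B_j - (K₀ |A_j|² + K₁ |A_l|²) A_j - r_j(A, B)`,
where `{j, l} = {1, 2}` and `r = (r₁, r₂)` are the higher-order terms. -/
def reducedField (θ c₀ μ₀ K₀ K₁ : ℝ) (r : Phase4 → ℝ × ℝ) : Phase4 → Phase4 :=
  fun x =>
    let A₁ := x.1
    let B₁ := x.2.1
    let A₂ := x.2.2.1
    let B₂ := x.2.2.2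
    let m₁ := 4 * (inner ℝ (dir θ) k₁) ^ 2
    let m₂ := 4 * (inner ℝ (dir θ) k₂) ^ 2
    ( B₁,
      - (μ₀ / m₁) * A₁ - (c₀ / m₁) * B₁
        - (1 / m₁) * ((K₀ * |A₁| ^ 2 + K₁ * |A₂| ^ 2) * A₁) - (1 / m₁) * (r x).1,
      B₂,
      - (μ₀ / m₂) * A₂ - (c₀ / m₂) * B₂
        - (1 / m₂) * ((K₀ * |A₂| ^ 2 + K₁ * |A₁| ^ 2) * A₂) - (1 / m₂) * (r x).2 )

/-- Right-hand side of the slow subsystem for `θ = 0`: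
`A₁' = B₁`, `4 B₁' = - μ₀ A₁ - c₀ B₁ - (K₀ |A₁|² + K₁ |A₂|²) A₁ - r₁`,
`c₀ A₂' = - μ₀ A₂ - (K₀ |A₂|² + K₁ |A₁|²) A₂ - r₂`. -/
def slowField (c₀ μ₀ K₀ K₁ : ℝ) (r : Phase3 → ℝ × ℝ) : Phase3 → Phase3 :=
  fun x =>
    let A₁ := x.1
    let B₁ := x.2.1
    let A₂ := x.2.2
    ( B₁,
      - (μ₀ / 4) * A₁ - (c₀ / 4) * B₁
        - (1 / 4) * ((K₀ * |A₁| ^ 2 + K₁ * |A₂| ^ 2) * A₁) - (1 / 4) * (r x).1,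
      (1 / c₀) * (- μ₀ * A₂ - (K₀ * |A₂| ^ 2 + K₁ * |A₁| ^ 2) * A₂ - (r x).2) )

/-- `r` is a family of higher-order terms of order `O(ε)` as `ε ↓ 0`: it preserves the trivial
state, and on every bounded ball it is `C¹` and, together with its first derivative, bounded by a
constant times `ε`, for all sufficiently small `ε > 0`. -/
structure IsHigherOrder {E : Type*} [NormedAddCommGroup E] [NormedSpace ℝ E]
    (r : ℝ → E → ℝ × ℝ) : Prop where
  map_zero : ∀ᶠ ε in 𝓝[>] (0 : ℝ), r ε 0 = 0
  isBigO : ∀ ρ > (0 : ℝ), ∃ C : ℝ, ∀ᶠ ε in 𝓝[>] (0 : ℝ),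
    ContDiffOn ℝ 1 (r ε) (Metric.ball 0 ρ) ∧
    ∀ x ∈ Metric.ball (0 : E) ρ, ‖r ε x‖ ≤ C * ε ∧ ‖fderiv ℝ (r ε) x‖ ≤ C * ε

/-- The symmetries that the square lattice imposes on the higher-order terms of the real
four-dimensional system: translation by half a period in either lattice direction
(`(A_j, B_j) ↦ -(A_j, B_j)`), and the exchange of the two modes for steady patterns (`B = 0`). -/
structure IsLatticeSymmetric4 (r : Phase4 → ℝ × ℝ) : Prop where
  neg_fst : ∀ A₁ B₁ A₂ B₂ : ℝ,
    r (-A₁, -B₁, A₂, B₂) = (-(r (A₁, B₁, A₂, B₂)).1, (r (A₁, B₁, A₂, B₂)).2)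
  neg_snd : ∀ A₁ B₁ A₂ B₂ : ℝ,
    r (A₁, B₁, -A₂, -B₂) = ((r (A₁, B₁, A₂, B₂)).1, -(r (A₁, B₁, A₂, B₂)).2)
  exchange : ∀ A : ℝ × ℝ, r (embed4 A.swap) = (r (embed4 A)).swap

/-- The same symmetries for the higher-order terms of the slow subsystem. -/
structure IsLatticeSymmetric3 (r : Phase3 → ℝ × ℝ) : Prop where
  neg_fst : ∀ A₁ B₁ A₂ : ℝ, r (-A₁, -B₁, A₂) = (-(r (A₁, B₁, A₂)).1, (r (A₁, B₁, A₂)).2)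
  neg_snd : ∀ A₁ B₁ A₂ : ℝ, r (A₁, B₁, -A₂) = ((r (A₁, B₁, A₂)).1, -(r (A₁, B₁, A₂)).2)
  exchange : ∀ A : ℝ × ℝ, r (embed3 A.swap) = (r (embed3 A)).swap

/-- `u : ℝ → E` is a heteroclinic orbit of `u' = F u` from the equilibrium `p` to the
equilibrium `q`. -/
structure IsHeteroclinic {E : Type*} [NormedAddCommGroup E] [NormedSpace ℝ E]
    (F : E → E) (p q : E) (u : ℝ → E) : Prop where
  equilibrium_source : F p = 0
  equilibrium_target : F q = 0
  source_ne_target : p ≠ q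
  solution : ∀ t : ℝ, HasDerivAt u (F (u t)) t
  tendsto_atBot : Tendsto u atBot (𝓝 p)
  tendsto_atTop : Tendsto u atTop (𝓝 q)

/-- The square equilibria `𝐀_S` of the leading-order system. -/
def squares (μ₀ K₀ K₁ : ℝ) : Set (ℝ × ℝ) :=
  {A | |A.1| = Real.sqrt (-(μ₀ / (K₀ + K₁))) ∧ |A.2| = Real.sqrt (-(μ₀ / (K₀ + K₁)))}

/-- The roll-wave equilibria `𝐀_R` of the leading-order system. -/
def rolls (μ₀ K₀ : ℝ) : Set (ℝ × ℝ) :=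
  {A | |A.1| = Real.sqrt (-(μ₀ / K₀)) ∧ A.2 = 0}

/-- Amplitudes of square shape. -/
def IsSquareShape (A : ℝ × ℝ) : Prop := |A.1| = |A.2| ∧ A.1 ≠ 0

/-- Amplitudes of roll shape. -/
def IsRollShape (A : ℝ × ℝ) : Prop := A.1 ≠ 0 ∧ A.2 = 0

/-- In a system with right-hand side `F r`, depending on higher-order terms `r`, there are orbits
from the pattern `A` to the trivial state: exactly from `A` in the leading-order system (`r = 0`),
and, for all higher-order terms `r ε` of order `O(ε)` and all sufficiently small `ε > 0`, from an
equilibrium with amplitudes `A'` at distance `O(ε)` from `A`. If the higher-order terms have the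
symmetries of the lattice, then `A'` is a pattern of the same shape. -/
def ConnectsToTrivial {E : Type*} [NormedAddCommGroup E] [NormedSpace ℝ E]
    (F : (E → ℝ × ℝ) → E → E) (embed : ℝ × ℝ → E)
    (sym : (E → ℝ × ℝ) → Prop) (shape : ℝ × ℝ → Prop) (A : ℝ × ℝ) : Prop :=
  (∃ u : ℝ → E, IsHeteroclinic (F 0) (embed A) (embed 0) u) ∧
  ∀ r : ℝ → E → ℝ × ℝ, IsHigherOrder r →
    ∃ C : ℝ, ∀ᶠ ε in 𝓝[>] (0 : ℝ), ∃ A' : ℝ × ℝ,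
      ‖A' - A‖ ≤ C * ε ∧ (sym (r ε) → shape A') ∧
      ∃ u : ℝ → E, IsHeteroclinic (F (r ε)) (embed A') (embed 0) u

end SquareLattice

end

/-! Both systems are damped gradient systems: with the potential `V` whose gradient is the cubic
`force`, they read m A'' + c₀ A' = -∇V(A) with positive masses, except that at θ = 0 the second
amplitude has no inertia. In the corrected energy `lyapunov`, the kinetic energy plus `V` is
dissipated by c₀|A'|² only, while a small multiple γ of the cross term m A'·∇V adds a decay of order
γ|∇V|². The result is a strict Lyapunov function `W`.

The connected pattern p minimises `V` on the circle |A|² = P through p, where `V` has height above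
`V(p)` proportional to |∇V|². Radially p is a maximum, and the origin is the only critical point
inside the circle. Completing squares carries this over to phase space: `W ≥ W p` on the cylinder
over the circle. Hence the part of the solid cylinder with `W ≤ w₁ < W p` cannot be left forward in
time, and every orbit in it tends to 0. It remains to find an orbit that emanates from p and enters
this set.

That orbit comes from the Hessian `B` of `W` at p, in place of an unstable manifold theorem. The
form `B` is strictly dissipated by the linearisation, and the cone `B ≤ 0` is split into two
components by the differential of `h = |A|² - P`. Trajectories started ever closer to p in the
inward component leave a fixed small sphere after ever longer times. A limit of the exit points
carries a backward orbit which stays in the cone and converges to p (`exists_unstable_orbit`).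

Every estimate is open, so the same `W`, `h` and `B` serve the perturbed field as soon as its
difference from the leading-order field has a small Lipschitz constant. Near 0 this suffices because
0 remains an equilibrium; near p the perturbed equilibrium p' takes over. It exists and is locally
unique by a quantitative inverse function argument, and uniqueness forces p' to inherit the
reflection that fixes p, hence its shape. `IsMountainPass.exists_connection` collects this, and
`IsDampedGradient.exists_isMountainPass` supplies its hypotheses. -/

namespace SquareLattice

/-! ### Global flows, continuous dependence and convergence by dissipation. -/

section Flow

variable {E : Type*} [NormedAddCommGroup E] [NormedSpace ℝ E]

/-- A bounded, globally Lipschitz vector field on a Banach space is complete. -/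
theorem exists_global_solution [CompleteSpace E] {G : E → E} {K M : NNReal}
    (hL : LipschitzWith K G) (hM : ∀ x, ‖G x‖ ≤ M) (x : E) :
    ∃ u : ℝ → E, u 0 = x ∧ ∀ t, HasDerivAt u (G (u t)) t := by
  have hloc : ∀ n : ℕ, ∃ α : ℝ → E, α 0 = x ∧
      ∀ t ∈ Ioo (-((n : ℝ) + 1)) (n + 1), HasDerivAt α (G (α t)) t := by
    intro n
    have hn : (0 : ℝ) ≤ n := n.cast_nonneg
    have hpl : IsPicardLindelof (fun _ ↦ G) (tmin := -((n : ℝ) + 1)) (tmax := n + 1)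
        ⟨0, by constructor <;> linarith⟩ x (M * (n + 1)) 0 M K := by
      refine IsPicardLindelof.of_time_independent (fun y _ ↦ hM y) hL.lipschitzOnWith ?_
      simp
    obtain ⟨α, h0, hα⟩ := hpl.exists_eq_forall_mem_Icc_hasDerivWithinAt₀
    exact ⟨α, h0, fun t ht ↦
      (hα t (Ioo_subset_Icc_self ht)).hasDerivAt (Icc_mem_nhds ht.1 ht.2)⟩
  choose α hα0 hα using hloc
  have hagree : ∀ n m : ℕ, n ≤ m → ∀ t : ℝ, |t| < n + 1 → α n t = α m t := by
    intro n m hnm t ht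
    have hn : (0 : ℝ) ≤ n := n.cast_nonneg
    have hnm' : (n : ℝ) ≤ m := by exact_mod_cast hnm
    refine ODE_solution_unique_of_mem_Ioo (v := fun _ ↦ G) (s := fun _ ↦ univ) (K := K)
      (a := -((n : ℝ) + 1)) (b := n + 1) (t₀ := 0) (fun _ _ ↦ hL.lipschitzOnWith)
      ⟨by linarith, by linarith⟩ (fun s hs ↦ ⟨hα n s hs, mem_univ _⟩)
      (fun s hs ↦ ⟨hα m s ⟨by linarith [hs.1], by linarith [hs.2]⟩, mem_univ _⟩)
      (by rw [hα0, hα0]) (abs_lt.1 ht)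
  -- The local solutions are glued along the index ⌈|t|⌉. It may jump near `t`, but it stays at most
  -- ⌈|t|⌉ + 1 there, so the single solution with that index represents the glued curve locally.
  refine ⟨fun t ↦ α ⌈|t|⌉₊ t, by simp [hα0], fun t ↦ ?_⟩
  have hceil : |t| ≤ ⌈|t|⌉₊ := Nat.le_ceil _
  have hev : (fun s ↦ α ⌈|s|⌉₊ s) =ᶠ[𝓝 t] α (⌈|t|⌉₊ + 1) := by
    have : ∀ᶠ s in 𝓝 t, |s| < |t| + 1 :=
      continuous_abs.continuousAt.eventually_lt continuousAt_const (by simp)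
    filter_upwards [this] with s hs
    refine hagree _ _ ?_ s (by linarith [Nat.le_ceil |s|])
    refine Nat.ceil_le.2 ?_
    push_cast
    linarith
  have hd : HasDerivAt (α (⌈|t|⌉₊ + 1)) (G (α (⌈|t|⌉₊ + 1) t)) t := by
    refine hα _ t (abs_lt.1 ?_)
    push_cast
    linarith
  have := hd.congr_of_eventuallyEq hev
  rwa [← hev.self_of_nhds] at this

theorem dist_le_of_solutions_forward {G : E → E} {K : NNReal} (hL : LipschitzWith K G)
    {u v : ℝ → E} (hu : ∀ t, HasDerivAt u (G (u t)) t) (hv : ∀ t, HasDerivAt v (G (v t)) t)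
    {t : ℝ} (ht : 0 ≤ t) : dist (u t) (v t) ≤ dist (u 0) (v 0) * Real.exp (K * t) := by
  have := dist_le_of_trajectories_ODE (v := fun _ ↦ G) (a := 0) (b := t) (fun _ ↦ hL)
    (fun s _ ↦ (hu s).continuousAt.continuousWithinAt) (fun s _ ↦ (hu s).hasDerivWithinAt)
    (fun s _ ↦ (hv s).continuousAt.continuousWithinAt) (fun s _ ↦ (hv s).hasDerivWithinAt)
    le_rfl t ⟨ht, le_rfl⟩
  simpa using this

/-- Continuous dependence of solutions on their initial values. -/
theorem dist_le_of_solutions {G : E → E} {K : NNReal} (hL : LipschitzWith K G)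
    {u v : ℝ → E} (hu : ∀ t, HasDerivAt u (G (u t)) t) (hv : ∀ t, HasDerivAt v (G (v t)) t)
    (t : ℝ) : dist (u t) (v t) ≤ dist (u 0) (v 0) * Real.exp (K * |t|) := by
  rcases le_total 0 t with ht | ht
  · rw [abs_of_nonneg ht]
    exact dist_le_of_solutions_forward hL hu hv ht
  · have hneg : LipschitzWith K (fun x ↦ -G x) := hL.neg
    have hrev : ∀ w : ℝ → E, (∀ t, HasDerivAt w (G (w t)) t) →
        ∀ t, HasDerivAt (fun s ↦ w (-s)) (-G (w (-t))) t := by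
      intro w hw t
      have := (hw (-t)).scomp t (hasDerivAt_neg t)
      simpa [Function.comp_def] using this
    have := dist_le_of_solutions_forward hneg (hrev u hu) (hrev v hv) (neg_nonneg.2 ht)
    rw [abs_of_nonpos ht]
    simpa using this

theorem hasDerivAt_translate {G : E → E} {u : ℝ → E} (hu : ∀ t, HasDerivAt u (G (u t)) t)
    (a : ℝ) (t : ℝ) : HasDerivAt (fun s ↦ u (a + s)) (G (u (a + t))) t := by
  exact (hu (a + t)).comp_const_add a t

theorem norm_sub_le_of_deriv_le {u : ℝ → E} {u' : ℝ → E} {M : ℝ}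
    {s t : ℝ} (hu : ∀ r ∈ uIcc s t, HasDerivAt u (u' r) r) (hM : ∀ r ∈ uIcc s t, ‖u' r‖ ≤ M) :
    ‖u t - u s‖ ≤ M * |t - s| := by
  have := (convex_uIcc s t).norm_image_sub_le_of_norm_hasDerivWithin_le
    (fun r hr ↦ (hu r hr).hasDerivWithinAt) hM left_mem_uIcc right_mem_uIcc
  simpa using this

theorem le_sub_of_deriv_le {S S' : ℝ → ℝ} {k s t : ℝ} (hst : s ≤ t)
    (hS : ∀ r ∈ Icc s t, HasDerivAt S (S' r) r) (hk : ∀ r ∈ Icc s t, S' r ≤ -k) :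
    S t ≤ S s - k * (t - s) := by
  rcases hst.eq_or_lt with rfl | hlt
  · simp
  obtain ⟨r, hr, he⟩ := exists_hasDerivAt_eq_slope S S' hlt
    (fun r hr ↦ (hS r hr).continuousAt.continuousWithinAt)
    (fun r hr ↦ hS r (Ioo_subset_Icc_self hr))
  have := hk r (Ioo_subset_Icc_self hr)
  rw [he, div_le_iff₀ (by linarith)] at this
  linarith

/-- If a quantity bounded from below decreases at a rate at least `c ‖w‖²` along a Lipschitz
curve `w`, then `w` converges to zero. -/
theorem tendsto_zero_of_dissipation {X : Type*} [NormedAddCommGroup X] {w : ℝ → X}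
    {S S' : ℝ → ℝ} {M c b : ℝ} (hM : 0 < M)
    (hc : 0 < c) (hw : ∀ s t, 0 ≤ s → 0 ≤ t → ‖w t - w s‖ ≤ M * |t - s|)
    (hS : ∀ t, 0 ≤ t → HasDerivAt S (S' t) t) (hS' : ∀ t, 0 ≤ t → S' t ≤ -(c * ‖w t‖ ^ 2))
    (hb : ∀ t, 0 ≤ t → b ≤ S t) : Tendsto w atTop (𝓝 0) := by
  have hdrop : ∀ s t, 0 ≤ s → s ≤ t → S t ≤ S s := by
    intro s t hs hst
    have := le_sub_of_deriv_le (k := 0) hst (fun r hr ↦ hS r (hs.trans hr.1))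
      (fun r hr ↦ (hS' r (hs.trans hr.1)).trans (by nlinarith [sq_nonneg ‖w r‖]))
    simpa using this
  obtain ⟨l, hl⟩ : ∃ l, Tendsto S atTop (𝓝 l) := by
    -- Nothing is known at negative times, so `S` is frozen there to obtain a globally antitone
    -- function.
    have hanti : Antitone (fun t ↦ S (max t 0)) := fun s t hst ↦
      hdrop _ _ (le_max_right _ _) (max_le_max hst le_rfl)
    have hbdd : BddBelow (range fun t ↦ S (max t 0)) := by
      refine ⟨b, ?_⟩
      rintro _ ⟨t, rfl⟩
      exact hb _ (le_max_right _ _)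
    refine ⟨_, (tendsto_atTop_ciInf hanti hbdd).congr' ?_⟩
    filter_upwards [eventually_ge_atTop (0 : ℝ)] with t ht
    rw [max_eq_left ht]
  rw [Metric.tendsto_atTop']
  intro δ hδ
  -- If ‖w t‖ ≥ δ, the Lipschitz bound keeps ‖w‖ ≥ δ/2 for a further time τ. Then `S` drops by at
  -- least c(δ/2)²τ on that interval, which is impossible for late `t` because `S` converges.
  set τ := δ / (2 * M) with hτ
  have hτ0 : 0 < τ := by positivity
  have hdiff : Tendsto (fun t ↦ S t - S (t + τ)) atTop (𝓝 0) := by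
    have := hl.sub (hl.comp (tendsto_atTop_add_const_right _ τ tendsto_id))
    simpa using this
  have hk : 0 < c * (δ / 2) ^ 2 * τ := by positivity
  obtain ⟨T, hT⟩ := eventually_atTop.1
    ((hdiff.eventually_lt_const hk).and (eventually_ge_atTop (0 : ℝ)))
  refine ⟨T, fun t ht ↦ ?_⟩
  obtain ⟨h1, h0⟩ := hT t ht.le
  rw [dist_zero_right]
  by_contra! hge
  have := le_sub_of_deriv_le (k := c * (δ / 2) ^ 2) (s := t) (t := t + τ) (by linarith)
    (fun r hr ↦ hS r (h0.trans hr.1)) (fun r hr ↦ by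
      refine (hS' r (h0.trans hr.1)).trans (neg_le_neg ?_)
      have hd := hw t r h0 (h0.trans hr.1)
      have hr' : M * |r - t| ≤ δ / 2 := by
        rw [abs_of_nonneg (by linarith [hr.1])]
        calc M * (r - t) ≤ M * τ := by gcongr; linarith [hr.2]
          _ = δ / 2 := by rw [hτ]; field_simp
      have htri : ‖w t‖ ≤ ‖w r‖ + ‖w r - w t‖ := by
        have := norm_sub_le (w r) (w r - w t)
        simpa using this
      have : δ / 2 ≤ ‖w r‖ := by linarith
      gcongr)
  rw [add_sub_cancel_left] at this
  linarith

end Flow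

/-! ### Unstable orbits from an indefinite quadratic form. -/

section UnstableOrbit

variable {E : Type*} [NormedAddCommGroup E] [NormedSpace ℝ E]

theorem hasDerivAt_quadratic {B : E →L[ℝ] E →L[ℝ] ℝ} (hsymm : ∀ v w, B v w = B w v)
    {w : ℝ → E} {w' : E} {t : ℝ} (hw : HasDerivAt w w' t) :
    HasDerivAt (fun s ↦ B (w s) (w s)) (2 * B (w t) w') t := by
  have h := (B.hasFDerivAt.comp_hasDerivAt t hw).clm_apply hw
  convert! h using 1
  rw [two_mul, hsymm w' (w t)]
  rfl

/-- A trajectory that starts in the unstable cone of an equilibrium reaches every small sphere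
around it, through the same component of the cone. -/
theorem exists_exit_time {G : E → E} {p : E} {B : E →L[ℝ] E →L[ℝ] ℝ}
    (hsymm : ∀ v w, B v w = B w v) {c η M : ℝ} (hc : 0 < c) (hη : 0 < η) (hM : 0 < M)
    (hB : ∀ w, ‖w‖ ≤ η → B w (G (p + w)) ≤ -(c * ‖w‖ ^ 2))
    (hG : ∀ w, ‖w‖ ≤ η → ‖G (p + w)‖ ≤ M * η)
    {ℓ : E →L[ℝ] ℝ} (hcone : ∀ w, w ≠ 0 → B w w ≤ 0 → ℓ w ≠ 0)
    {u : ℝ → E} (hu : ∀ t, HasDerivAt u (G (u t)) t) (h0 : ‖u 0 - p‖ < η)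
    (hB0 : B (u 0 - p) (u 0 - p) < 0) (hℓ0 : 0 < ℓ (u 0 - p)) :
    ∃ T, 0 ≤ T ∧ ‖u T - p‖ = η ∧ ∀ t ∈ Icc 0 T,
      ‖u t - p‖ ≤ η ∧ B (u t - p) (u t - p) ≤ 0 ∧ 0 ≤ ℓ (u t - p) := by
  have hwd : ∀ t, HasDerivAt (fun s ↦ u s - p) (G (u t)) t := fun t ↦ (hu t).sub_const p
  have hwc : Continuous (fun s ↦ u s - p) :=
    continuous_iff_continuousAt.2 fun t ↦ (hwd t).continuousAt
  have hSd : ∀ t, HasDerivAt (fun s ↦ B (u s - p) (u s - p)) (2 * B (u t - p) (G (u t))) t :=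
    fun t ↦ hasDerivAt_quadratic hsymm (hwd t)
  have hdis : ∀ t, ‖u t - p‖ ≤ η → 2 * B (u t - p) (G (u t)) ≤ -(2 * c * ‖u t - p‖ ^ 2) := by
    intro t ht
    have := hB _ ht
    rw [add_sub_cancel] at this
    linarith
  have hdec : ∀ t, 0 ≤ t → (∀ r ∈ Icc 0 t, ‖u r - p‖ ≤ η) → B (u t - p) (u t - p) < 0 := by
    intro t ht hr
    have := le_sub_of_deriv_le (k := 0) ht (fun r _ ↦ hSd r)
      (fun r h ↦ (hdis r (hr r h)).trans (by
        have : 0 ≤ 2 * c * ‖u r - p‖ ^ 2 := by positivity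
        linarith))
    linarith
  -- A trajectory that never reached the sphere would converge to `p` by dissipation. Its form value
  -- would then tend to 0, although it starts negative and does not increase.
  have hex : ∃ t, 0 ≤ t ∧ η ≤ ‖u t - p‖ := by
    by_contra! hlt
    have hle : ∀ t, 0 ≤ t → ‖u t - p‖ ≤ η := fun t ht ↦ (hlt t ht).le
    have hlim : Tendsto (fun t ↦ u t - p) atTop (𝓝 0) := by
      refine tendsto_zero_of_dissipation (M := M * η) (c := 2 * c) (b := -(‖B‖ * η * η))
        (by positivity) (by positivity) ?_ (fun t _ ↦ hSd t) (fun t ht ↦ hdis t (hle t ht)) ?_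
      · intro s t hs ht
        refine norm_sub_le_of_deriv_le (fun r _ ↦ hwd r) (fun r hr ↦ ?_)
        have hr0 : 0 ≤ r := (le_min hs ht).trans hr.1
        have := hG _ (hle r hr0)
        rwa [add_sub_cancel] at this
      · intro t ht
        have h1 : |B (u t - p) (u t - p)| ≤ ‖B‖ * ‖u t - p‖ * ‖u t - p‖ := B.le_opNorm₂ _ _
        have h2 : ‖B‖ * ‖u t - p‖ * ‖u t - p‖ ≤ ‖B‖ * η * η := by
          gcongr <;> exact hle t ht
        linarith [neg_abs_le (B (u t - p) (u t - p))]
    have hS : Tendsto (fun t ↦ B (u t - p) (u t - p)) atTop (𝓝 0) := by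
      have hc2 : Continuous (fun w : E ↦ B w w) := by fun_prop
      have := (hc2.tendsto 0).comp hlim
      simpa [Function.comp_def] using this
    have hle0 : ∀ᶠ t in atTop, B (u t - p) (u t - p) ≤ B (u 0 - p) (u 0 - p) := by
      filter_upwards [eventually_ge_atTop (0 : ℝ)] with t ht
      have := le_sub_of_deriv_le (k := 0) ht (fun r _ ↦ hSd r)
        (fun r h ↦ (hdis r (hle r h.1)).trans (by
          have : 0 ≤ 2 * c * ‖u r - p‖ ^ 2 := by positivity
          linarith))
      linarith
    linarith [le_of_tendsto hS hle0]
  have hreach : ∀ t, 0 ≤ t → η ≤ ‖u t - p‖ → ∃ s ∈ Icc 0 t, ‖u s - p‖ = η := fun t ht hηt ↦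
    intermediate_value_Icc ht hwc.norm.continuousOn ⟨h0.le, hηt⟩
  let Z : Set ℝ := {t | 0 ≤ t ∧ ‖u t - p‖ = η}
  have hZne : Z.Nonempty := by
    obtain ⟨t, ht, hηt⟩ := hex
    obtain ⟨s, hs, he⟩ := hreach t ht hηt
    exact ⟨s, hs.1, he⟩
  have hZcl : IsClosed Z := (isClosed_le continuous_const continuous_id).inter
    (isClosed_eq hwc.norm continuous_const)
  have hZb : BddBelow Z := ⟨0, fun t ht ↦ ht.1⟩
  obtain ⟨hT0, hT⟩ := hZcl.csInf_mem hZne hZb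
  have hin : ∀ t ∈ Icc 0 (sInf Z), ‖u t - p‖ ≤ η := by
    intro t ht
    by_contra! hgt
    obtain ⟨s, hs, he⟩ := hreach t ht.1 hgt.le
    have h1 : sInf Z ≤ s := csInf_le hZb ⟨hs.1, he⟩
    have h2 : s = t := le_antisymm hs.2 (ht.2.trans h1)
    rw [h2] at he
    linarith
  refine ⟨sInf Z, hT0, hT, fun t ht ↦ ?_⟩
  have hneg : ∀ s ∈ Icc 0 t, B (u s - p) (u s - p) < 0 := fun s hs ↦
    hdec s hs.1 fun r hr ↦ hin r ⟨hr.1, hr.2.trans (hs.2.trans ht.2)⟩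
  refine ⟨hin t ht, (hneg t ⟨ht.1, le_rfl⟩).le, ?_⟩
  -- To change component, `ℓ` would have to vanish at some time. There the form is still negative,
  -- which the cone condition excludes.
  by_contra! hlt
  obtain ⟨s, hs, he⟩ := intermediate_value_Icc' ht.1
    (ℓ.continuous.comp hwc).continuousOn ⟨hlt.le, hℓ0.le⟩
  refine hcone _ (fun h ↦ ?_) (hneg s hs).le he
  have := hneg s hs
  rw [h] at this
  simp at this

/-- An equilibrium with a strictly dissipated indefinite quadratic form `B` has an orbit that
emanates from it in a prescribed component of the cone `B ≤ 0`. -/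
theorem exists_unstable_orbit [FiniteDimensional ℝ E] {G : E → E} {K : NNReal}
    (hL : LipschitzWith K G)
    (hsol : ∀ x, ∃ u : ℝ → E, u 0 = x ∧ ∀ t, HasDerivAt u (G (u t)) t)
    {p : E} (hp : G p = 0) {B : E →L[ℝ] E →L[ℝ] ℝ}
    (hsymm : ∀ v w, B v w = B w v) {c η M : ℝ} (hc : 0 < c) (hη : 0 < η) (hM : 0 < M)
    (hB : ∀ w, ‖w‖ ≤ η → B w (G (p + w)) ≤ -(c * ‖w‖ ^ 2))
    (hG : ∀ w, ‖w‖ ≤ η → ‖G (p + w)‖ ≤ M * η)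
    {ℓ : E →L[ℝ] ℝ} (hcone : ∀ w, w ≠ 0 → B w w ≤ 0 → ℓ w ≠ 0)
    {v : E} (hv : B v v < 0) (hℓ : 0 < ℓ v) :
    ∃ u : ℝ → E, (∀ t, HasDerivAt u (G (u t)) t) ∧ Tendsto u atBot (𝓝 p) ∧
      (∀ t ≤ 0, ‖u t - p‖ ≤ η) ∧ ‖u 0 - p‖ = η ∧ 0 ≤ ℓ (u 0 - p) ∧
      B (u 0 - p) (u 0 - p) ≤ -(c / (4 * M) * η ^ 2) := by
  choose φ hφ0 hφ using hsol
  have hv0 : v ≠ 0 := by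
    rintro rfl
    simp at hv
  have hvpos : 0 < ‖v‖ := norm_pos_iff.2 hv0
  -- Step sizes tending to 0 that keep all starting points p + s n • v within η/2 of `p`.
  let s : ℕ → ℝ := fun n ↦ η / (2 * ‖v‖) / (n + 1)
  have hs0 : ∀ n, 0 < s n := fun n ↦ by positivity
  have hslim : Tendsto s atTop (𝓝 0) := by
    have := (tendsto_one_div_add_atTop_nhds_zero_nat (𝕜 := ℝ)).const_mul (η / (2 * ‖v‖))
    simp only [mul_zero] at this
    exact this.congr fun n ↦ by simp [s, div_eq_mul_inv]
  have hsη : ∀ n, s n * ‖v‖ < η := by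
    intro n
    have h1 : s n ≤ η / (2 * ‖v‖) := div_le_self (by positivity) (by
      have : (0 : ℝ) ≤ n := n.cast_nonneg
      linarith)
    calc s n * ‖v‖ ≤ η / (2 * ‖v‖) * ‖v‖ := by gcongr
      _ = η / 2 := by field_simp
      _ < η := by linarith
  let x : ℕ → E := fun n ↦ p + s n • v
  have hx : ∀ n, φ (x n) 0 - p = s n • v := fun n ↦ by rw [hφ0]; simp [x]
  have hxn : ∀ n, ‖φ (x n) 0 - p‖ = s n * ‖v‖ := fun n ↦ by
    rw [hx, norm_smul, Real.norm_of_nonneg (hs0 n).le]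
  have hexit : ∀ n, ∃ T, 0 ≤ T ∧ ‖φ (x n) T - p‖ = η ∧ ∀ t ∈ Icc 0 T,
      ‖φ (x n) t - p‖ ≤ η ∧ B (φ (x n) t - p) (φ (x n) t - p) ≤ 0 ∧ 0 ≤ ℓ (φ (x n) t - p) := by
    intro n
    refine exists_exit_time hsymm hc hη hM hB hG hcone (hφ _) ?_ ?_ ?_
    · rw [hxn]
      exact hsη n
    · rw [hx]
      simp only [map_smul, smul_apply, smul_eq_mul]
      nlinarith [mul_pos (hs0 n) (hs0 n)]
    · rw [hx, map_smul, smul_eq_mul]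
      exact mul_pos (hs0 n) hℓ
  choose T hT0 hTη hT using hexit
  -- By comparison with the constant solution `p`, distances grow at most like exp(Kt), so starting
  -- points approaching `p` need unbounded time to exit.
  have hTlim : Tendsto T atTop atTop := by
    refine tendsto_atTop.2 fun A ↦ ?_
    have h1 : Tendsto (fun n ↦ s n * ‖v‖ * Real.exp (K * A)) atTop (𝓝 0) := by
      have := (hslim.mul_const ‖v‖).mul_const (Real.exp (K * A))
      simpa using this
    filter_upwards [h1.eventually_lt_const hη] with n hn
    by_contra! hlt
    have h2 := dist_le_of_solutions hL (hφ (x n)) (v := fun _ ↦ p)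
      (fun t ↦ by rw [hp]; exact hasDerivAt_const t p) (T n)
    rw [dist_eq_norm, dist_eq_norm, hTη, hxn, abs_of_nonneg (hT0 n)] at h2
    have h3 : Real.exp (K * T n) ≤ Real.exp (K * A) :=
      Real.exp_le_exp.2 (mul_le_mul_of_nonneg_left hlt.le K.coe_nonneg)
    have h4 : 0 ≤ s n * ‖v‖ := mul_nonneg (hs0 n).le hvpos.le
    linarith [mul_le_mul_of_nonneg_left h3 h4]
  have : ProperSpace E := FiniteDimensional.proper_real E
  obtain ⟨q, hq, ψ, hψ, hlim⟩ := (isCompact_sphere p η).tendsto_subseq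
    (x := fun n ↦ φ (x n) (T n)) (fun n ↦ by rw [Metric.mem_sphere, dist_eq_norm]; exact hTη n)
  have hTψ : Tendsto (fun n ↦ T (ψ n)) atTop atTop := hTlim.comp hψ.tendsto_atTop
  -- Viewed from their exit times, the trajectories converge to the one through the limit exit point
  -- `q`. The closed conditions valid before exit thus hold along its whole backward orbit.
  have hlimt : ∀ t, Tendsto (fun n ↦ φ (x (ψ n)) (T (ψ n) + t)) atTop (𝓝 (φ q t)) := by
    intro t
    rw [tendsto_iff_dist_tendsto_zero]
    have h1 : Tendsto (fun n ↦ dist (φ (x (ψ n)) (T (ψ n))) q * Real.exp (K * |t|)) atTop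
        (𝓝 0) := by
      have := (tendsto_iff_dist_tendsto_zero.1 hlim).mul_const (Real.exp (K * |t|))
      simpa [Function.comp_def] using this
    refine squeeze_zero (fun _ ↦ dist_nonneg) (fun n ↦ ?_) h1
    have := dist_le_of_solutions hL (hasDerivAt_translate (hφ (x (ψ n))) (T (ψ n))) (hφ q) t
    simpa [hφ0] using this
  have hback : ∀ t ≤ 0, ‖φ q t - p‖ ≤ η ∧ B (φ q t - p) (φ q t - p) ≤ 0 ∧
      0 ≤ ℓ (φ q t - p) := by
    intro t ht
    have hcl1 : IsClosed {z : E | ‖z - p‖ ≤ η} := isClosed_le (by fun_prop) continuous_const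
    have hcl2 : IsClosed {z : E | B (z - p) (z - p) ≤ 0} :=
      isClosed_le (by fun_prop) continuous_const
    have hcl3 : IsClosed {z : E | 0 ≤ ℓ (z - p)} := isClosed_le continuous_const (by fun_prop)
    have hcl : IsClosed {z : E | ‖z - p‖ ≤ η ∧ B (z - p) (z - p) ≤ 0 ∧ 0 ≤ ℓ (z - p)} :=
      hcl1.inter (hcl2.inter hcl3)
    refine hcl.mem_of_tendsto (hlimt t) ?_
    filter_upwards [hTψ.eventually_ge_atTop (-t)] with n hn
    exact hT (ψ n) _ ⟨by linarith, by linarith⟩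
  have hwd : ∀ t, HasDerivAt (fun s ↦ φ q s - p) (G (φ q t)) t := fun t ↦ (hφ q t).sub_const p
  have hSd : ∀ t, HasDerivAt (fun s ↦ B (φ q s - p) (φ q s - p))
      (2 * B (φ q t - p) (G (φ q t))) t := fun t ↦ hasDerivAt_quadratic hsymm (hwd t)
  have hdis : ∀ t ≤ 0, 2 * B (φ q t - p) (G (φ q t)) ≤ -(2 * c * ‖φ q t - p‖ ^ 2) := by
    intro t ht
    have := hB _ (hback t ht).1
    rw [add_sub_cancel] at this
    linarith
  have hspeed : ∀ t ≤ 0, ‖G (φ q t)‖ ≤ M * η := by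
    intro t ht
    have := hG _ (hback t ht).1
    rwa [add_sub_cancel] at this
  have hq0 : ‖φ q 0 - p‖ = η := by rw [hφ0, ← dist_eq_norm]; exact hq
  refine ⟨φ q, hφ q, ?_, fun t ht ↦ (hback t ht).1, hq0, (hback 0 le_rfl).2.2, ?_⟩
  · have hrev : Tendsto (fun t ↦ φ q (-t) - p) atTop (𝓝 0) := by
      refine tendsto_zero_of_dissipation (M := M * η) (c := 2 * c) (b := 0)
        (S := fun t ↦ -B (φ q (-t) - p) (φ q (-t) - p))
        (S' := fun t ↦ 2 * B (φ q (-t) - p) (G (φ q (-t))))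
        (by positivity) (by positivity) ?_ ?_ (fun t ht ↦ hdis _ (neg_nonpos.2 ht))
        (fun t ht ↦ neg_nonneg.2 (hback _ (neg_nonpos.2 ht)).2.1)
      · intro s t hs ht
        have := norm_sub_le_of_deriv_le (s := -s) (t := -t) (fun r _ ↦ hwd r) (M := M * η)
          (fun r hr ↦ hspeed r (hr.2.trans (max_le (by linarith) (by linarith))))
        rwa [show -t - -s = -(t - s) by ring, abs_neg] at this
      · intro t _
        have := ((hSd (-t)).comp t (hasDerivAt_neg t)).neg
        convert! this using 1
        ring
    have h2 := hrev.comp tendsto_neg_atBot_atTop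
    have h3 := h2.add_const p
    simpa [Function.comp_def] using h3
  -- During the last time τ before exit the orbit is at distance at least η/2. The form, already
  -- nonpositive at time -τ, therefore drops by 2c(η/2)²τ = cη²/(4M).
  · set τ := 1 / (2 * M) with hτ
    have hτ0 : 0 < τ := by positivity
    have hlow : ∀ r ∈ Icc (-τ) 0, η / 2 ≤ ‖φ q r - p‖ := by
      intro r hr
      have h1 := norm_sub_le_of_deriv_le (s := r) (t := 0) (fun r _ ↦ hwd r) (M := M * η)
        (fun r' hr' ↦ hspeed r' (hr'.2.trans (max_le hr.2 le_rfl)))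
      rw [abs_of_nonneg (by linarith [hr.2])] at h1
      have h2 : M * η * (0 - r) ≤ η / 2 := by
        calc M * η * (0 - r) ≤ M * η * τ := by gcongr; linarith [hr.1]
          _ = η / 2 := by rw [hτ]; field_simp
      have h3 : ‖φ q 0 - p‖ ≤ ‖φ q r - p‖ + ‖φ q 0 - p - (φ q r - p)‖ := by
        have := norm_add_le (φ q r - p) (φ q 0 - p - (φ q r - p))
        rwa [add_sub_cancel] at this
      linarith
    have h1 := le_sub_of_deriv_le (k := 2 * c * (η / 2) ^ 2) (s := -τ) (t := 0) (by linarith)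
      (fun r _ ↦ hSd r) (fun r hr ↦ (hdis r hr.2).trans (neg_le_neg (by
        have := hlow r hr
        gcongr)))
    have h2 := (hback (-τ) (by linarith)).2.1
    have h3 : 2 * c * (η / 2) ^ 2 * (0 - -τ) = c / (4 * M) * η ^ 2 := by
      rw [hτ]
      field_simp
      ring
    linarith

end UnstableOrbit

/-! ### Trapping regions of a strict Lyapunov function. -/

section Trapping

variable {E : Type*} [NormedAddCommGroup E] [NormedSpace ℝ E]

/-- A sublevel set of a strict Lyapunov function, cut out by `h ≤ 0` and not meeting `h = 0`,
is forward invariant. -/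
theorem mem_of_trapping {G : E → E} {W h : E → ℝ} (hW : Differentiable ℝ W) (hh : Continuous h)
    {w₁ c : ℝ} (hc : 0 < c) (hneg : ∀ x, h x ≤ 0 → W x ≤ w₁ → h x < 0)
    (hdis : ∀ x, h x ≤ 0 → W x ≤ w₁ → fderiv ℝ W x (G x) ≤ -(c * ‖x‖ ^ 2)) (hW0 : W 0 < w₁)
    {u : ℝ → E} (hu : ∀ t, HasDerivAt u (G (u t)) t) (hu0 : h (u 0) ≤ 0) (hu1 : W (u 0) ≤ w₁)
    {t : ℝ} (ht : 0 ≤ t) : h (u t) ≤ 0 ∧ W (u t) ≤ w₁ := by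
  have huc : Continuous u := continuous_iff_continuousAt.2 fun t ↦ (hu t).continuousAt
  have hcl1 : IsClosed {s : ℝ | h (u s) ≤ 0} := isClosed_le (hh.comp huc) continuous_const
  have hcl2 : IsClosed {s : ℝ | W (u s) ≤ w₁} :=
    isClosed_le (hW.continuous.comp huc) continuous_const
  have hcl : IsClosed {s : ℝ | h (u s) ≤ 0 ∧ W (u s) ≤ w₁} := hcl1.inter hcl2
  -- Continuous induction in time. The condition on `h` persists because it holds strictly; the one
  -- on `W` persists at its boundary value because that level excludes the origin, so `W` is
  -- strictly decreasing there.
  refine (hcl.inter isClosed_Icc).Icc_subset_of_forall_mem_nhdsWithin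
    (a := 0) (b := t) ⟨hu0, hu1⟩ ?_ ⟨ht, le_rfl⟩
  rintro s ⟨⟨hs1, hs2⟩, -⟩
  have hev : ∀ᶠ r in 𝓝[>] s, h (u r) < 0 :=
    ((hh.comp huc).continuousAt.eventually_lt continuousAt_const
      (hneg _ hs1 hs2)).filter_mono nhdsWithin_le_nhds
  have hWd : HasDerivAt (fun r ↦ W (u r)) (fderiv ℝ W (u s) (G (u s))) s :=
    (hW (u s)).hasFDerivAt.comp_hasDerivAt s (hu s)
  have hev2 : ∀ᶠ r in 𝓝[>] s, W (u r) ≤ w₁ := by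
    rcases hs2.lt_or_eq with hlt | heq
    · refine (((hW.continuous.comp huc).continuousAt.eventually_lt continuousAt_const
        hlt).filter_mono nhdsWithin_le_nhds).mono fun r hr ↦ le_of_lt hr
    · have hne : u s ≠ 0 := by
        intro h0
        rw [h0] at heq
        linarith
      have hneg' : fderiv ℝ W (u s) (G (u s)) < 0 := by
        have h1 := hdis _ hs1 hs2
        have : 0 < ‖u s‖ := norm_pos_iff.2 hne
        have : 0 < c * ‖u s‖ ^ 2 := by positivity
        linarith
      have hslope := hasDerivAt_iff_tendsto_slope.1 hWd
      have hslope' := hslope.mono_left (nhdsWithin_mono s (fun r (hr : s < r) ↦ ne_of_gt hr))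
      filter_upwards [hslope'.eventually_lt_const hneg', self_mem_nhdsWithin] with r hr hsr
      rw [slope_def_field, div_lt_iff₀ (sub_pos.2 hsr)] at hr
      linarith
  filter_upwards [hev, hev2] with r h1 h2
  exact ⟨h1.le, h2⟩

theorem tendsto_zero_of_trapping {G : E → E} {W h : E → ℝ} (hW : Differentiable ℝ W)
    (hh : Continuous h) {w₁ c M b : ℝ} (hc : 0 < c) (hM : 0 < M)
    (hneg : ∀ x, h x ≤ 0 → W x ≤ w₁ → h x < 0)
    (hdis : ∀ x, h x ≤ 0 → W x ≤ w₁ → fderiv ℝ W x (G x) ≤ -(c * ‖x‖ ^ 2)) (hW0 : W 0 < w₁)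
    (hG : ∀ x, h x ≤ 0 → W x ≤ w₁ → ‖G x‖ ≤ M) (hb : ∀ x, h x ≤ 0 → W x ≤ w₁ → b ≤ W x)
    {u : ℝ → E} (hu : ∀ t, HasDerivAt u (G (u t)) t) (hu0 : h (u 0) ≤ 0) (hu1 : W (u 0) ≤ w₁) :
    Tendsto u atTop (𝓝 0) := by
  have hin : ∀ t, 0 ≤ t → h (u t) ≤ 0 ∧ W (u t) ≤ w₁ := fun t ht ↦
    mem_of_trapping hW hh hc hneg hdis hW0 hu hu0 hu1 ht
  refine tendsto_zero_of_dissipation (S := fun t ↦ W (u t))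
    (S' := fun t ↦ fderiv ℝ W (u t) (G (u t))) hM hc ?_
    (fun t _ ↦ (hW (u t)).hasFDerivAt.comp_hasDerivAt t (hu t))
    (fun t ht ↦ hdis _ (hin t ht).1 (hin t ht).2) (fun t ht ↦ hb _ (hin t ht).1 (hin t ht).2)
  intro s t hs ht
  refine norm_sub_le_of_deriv_le (fun r _ ↦ hu r) fun r hr ↦ ?_
  have := hin r ((le_min hs ht).trans hr.1)
  exact hG _ this.1 this.2

end Trapping

/-! ### Cutoff, linearisation and persistence of equilibria. -/

section LocalEstimates

variable {E : Type*} [NormedAddCommGroup E] [NormedSpace ℝ E]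

/-- A `C¹` vector field on a ball agrees on a smaller ball with a bounded, globally Lipschitz
vector field. -/
theorem exists_cutoff [FiniteDimensional ℝ E] {F : E → E} {R : ℝ} (hR : 0 < R)
    (hF : ContDiffOn ℝ 1 F (Metric.ball 0 (R + 1))) :
    ∃ (G : E → E) (K M : NNReal), LipschitzWith K G ∧ (∀ x, ‖G x‖ ≤ M) ∧
      ∀ x, ‖x‖ ≤ R → G x = F x := by
  -- The outer radius R + 1/2 keeps the support strictly inside the ball of radius R + 1 on which
  -- `F` is smooth.
  let χ : ContDiffBump (0 : E) := ⟨R, R + 1 / 2, hR, by linarith⟩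
  let G : E → E := fun x ↦ χ x • F x
  have hzero : ∀ x, x ∉ Metric.closedBall (0 : E) (R + 1 / 2) → χ x = 0 := by
    intro x hx
    have : x ∉ tsupport χ := by rwa [χ.tsupport_eq]
    exact image_eq_zero_of_notMem_tsupport this
  have hG : ContDiff ℝ 1 G := by
    refine contDiff_iff_contDiffAt.2 fun x ↦ ?_
    by_cases hx : x ∈ Metric.ball (0 : E) (R + 1)
    · exact χ.contDiffAt.smul (hF.contDiffAt (Metric.isOpen_ball.mem_nhds hx))
    · have hx' : x ∈ (Metric.closedBall (0 : E) (R + 1 / 2))ᶜ := by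
        intro h
        refine hx ?_
        rw [Metric.mem_ball]
        rw [Metric.mem_closedBall] at h
        linarith
      refine (contDiffAt_const (c := (0 : E))).congr_of_eventuallyEq ?_
      filter_upwards [Metric.isClosed_closedBall.isOpen_compl.mem_nhds hx'] with y hy
      simp only [G, hzero y hy, zero_smul]
  have hcs : HasCompactSupport G := by
    have : ProperSpace E := FiniteDimensional.proper_real E
    refine HasCompactSupport.intro (isCompact_closedBall 0 (R + 1 / 2)) fun x hx ↦ ?_
    simp only [G, hzero x hx, zero_smul]
  obtain ⟨K, hK⟩ := hG.lipschitzWith_of_hasCompactSupport hcs (by simp)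
  obtain ⟨C, hC⟩ := hcs.exists_bound_of_continuous hG.continuous
  refine ⟨G, K, ⟨max C 0, le_max_right _ _⟩, hK, fun x ↦ (hC x).trans (le_max_left _ _),
    fun x hx ↦ ?_⟩
  have : χ x = 1 := χ.one_of_mem_closedBall (by simpa using hx)
  simp only [G, this, one_smul]

theorem exists_lower_bound [FiniteDimensional ℝ E] {L : E →L[ℝ] E}
    (hL : Function.Injective L) : ∃ k > 0, ∀ w, k * ‖w‖ ≤ ‖L w‖ := by
  obtain ⟨K, hK, h⟩ := (LinearMap.injective_iff_antilipschitz (L : E →ₗ[ℝ] E)).1 hL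
  refine ⟨(K : ℝ)⁻¹, by positivity, fun w ↦ ?_⟩
  have h1 := h.le_mul_dist w 0
  simp only [dist_zero_right, map_zero] at h1
  rw [inv_mul_le_iff₀ (by positivity)]
  exact h1

/-- The linearized form of a dissipation inequality at an equilibrium. -/
theorem hessian_dissipation {F : E → E} {W : E → ℝ} {p : E} {L : E →L[ℝ] E}
    {B : E →L[ℝ] E →L[ℝ] ℝ} (hF : HasFDerivAt F L p) (hB : HasFDerivAt (fderiv ℝ W) B p)
    (hFp : F p = 0) (hWp : fderiv ℝ W p = 0) {c : ℝ}
    (hdis : ∀ᶠ x in 𝓝 p, fderiv ℝ W x (F x) ≤ -(c * ‖F x‖ ^ 2)) (w : E) :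
    B w (L w) ≤ -(c * ‖L w‖ ^ 2) := by
  have hline : HasDerivAt (fun t : ℝ ↦ p + t • w) w 0 := by
    simpa using ((hasDerivAt_id (0 : ℝ)).smul_const w).const_add p
  have hF' : HasDerivAt (fun t : ℝ ↦ F (p + t • w)) (L w) 0 := by
    refine HasFDerivAt.comp_hasDerivAt 0 ?_ hline
    simpa using hF
  have hB' : HasDerivAt (fun t : ℝ ↦ fderiv ℝ W (p + t • w)) (B w) 0 := by
    refine HasFDerivAt.comp_hasDerivAt 0 ?_ hline
    simpa using hB
  have h1 := hasDerivAt_iff_tendsto_slope_zero.1 hF'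
  have h2 := hasDerivAt_iff_tendsto_slope_zero.1 hB'
  simp only [zero_add, zero_smul, add_zero, hFp, hWp, sub_zero] at h1 h2
  -- Both the differential of `W` and the field vanish at `p`, so dividing the dissipation
  -- inequality at p + t w by t² leaves its linearisation in the limit.
  have h3 : Tendsto (fun t : ℝ ↦ (t⁻¹ • fderiv ℝ W (p + t • w)) (t⁻¹ • F (p + t • w))) (𝓝[≠] 0)
      (𝓝 (B w (L w))) :=
    (isBoundedBilinearMap_apply.continuous.tendsto (B w, L w)).comp (h2.prodMk_nhds h1)
  have h4 := ((h1.norm.pow 2).const_mul c).neg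
  refine le_of_tendsto_of_tendsto h3 h4 ?_
  have hcont : Tendsto (fun t : ℝ ↦ p + t • w) (𝓝[≠] 0) (𝓝 p) := by
    have := hline.continuousAt.tendsto
    simp only [zero_smul, add_zero] at this
    exact this.mono_left nhdsWithin_le_nhds
  filter_upwards [hcont.eventually hdis] with t ht
  simp only [smul_apply, map_smul, smul_eq_mul, norm_smul, norm_inv,
    Real.norm_eq_abs, mul_pow, inv_pow, sq_abs]
  have : 0 ≤ (t ^ 2)⁻¹ := by positivity
  calc t⁻¹ * (t⁻¹ * fderiv ℝ W (p + t • w) (F (p + t • w)))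
      = (t ^ 2)⁻¹ * fderiv ℝ W (p + t • w) (F (p + t • w)) := by rw [sq, mul_inv, mul_assoc]
    _ ≤ (t ^ 2)⁻¹ * -(c * ‖F (p + t • w)‖ ^ 2) := mul_le_mul_of_nonneg_left ht this
    _ = -(c * ((t ^ 2)⁻¹ * ‖F (p + t • w)‖ ^ 2)) := by ring

/-- A second-order Taylor estimate at a critical point. -/
theorem taylor_estimate {W : E → ℝ} {p : E} {B : E →L[ℝ] E →L[ℝ] ℝ}
    (hsymm : ∀ v w, B v w = B w v) (hW : Differentiable ℝ W)
    (hB : HasFDerivAt (fderiv ℝ W) B p) (hWp : fderiv ℝ W p = 0) {δ : ℝ} (hδ : 0 < δ) :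
    ∃ r > 0, ∀ z, ‖z‖ ≤ r → W (p + z) ≤ W p + B z z / 2 + δ * ‖z‖ ^ 2 := by
  have h1 := hasFDerivAt_iff_isLittleO_nhds_zero.1 hB
  have h2 := h1.def hδ
  obtain ⟨r, hr, hball⟩ := Metric.eventually_nhds_iff_ball.1 h2
  refine ⟨r / 2, by positivity, fun z hz ↦ ?_⟩
  -- The differential of this remainder is at most δ‖y‖, so the mean value inequality on the ball of
  -- radius ‖z‖ gives the quadratic bound.
  let φ : E → ℝ := fun y ↦ W (p + y) - B y y / 2
  have hφ : ∀ y, HasFDerivAt φ (fderiv ℝ W (p + y) - B y) y := by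
    intro y
    have h3 : HasFDerivAt (fun y ↦ W (p + y)) (fderiv ℝ W (p + y)) y := by
      have := (hW (p + y)).hasFDerivAt.comp y ((hasFDerivAt_id y).const_add p)
      simpa [Function.comp_def] using! this
    have h4 : HasFDerivAt (fun y ↦ B y y / 2) (B y) y := by
      have h5 := (B.hasFDerivAt (x := y)).clm_apply (hasFDerivAt_id y)
      have h6 := h5.const_mul (1 / 2 : ℝ)
      convert! h6 using 1
      · funext x
        simp only [id]
        ring
      · ext x
        simp [hsymm x y]
        ring
    exact h3.sub h4
  have h5 := (convex_closedBall (0 : E) ‖z‖).norm_image_sub_le_of_norm_hasFDerivWithin_le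
    (f := φ) (C := δ * ‖z‖) (fun y _ ↦ (hφ y).hasFDerivWithinAt) (fun y hy ↦ by
      have hy' : ‖y‖ ≤ ‖z‖ := by simpa using hy
      have := hball y (by
        rw [Metric.mem_ball, dist_zero_right]
        linarith)
      rw [hWp, sub_zero] at this
      exact this.trans (by gcongr))
    (x := 0) (y := z) (by simp) (by simp)
  simp only [φ, sub_zero, add_zero, map_zero, zero_div, Real.norm_eq_abs] at h5
  have := (abs_le.1 h5).2
  nlinarith

theorem first_order_estimate {h : E → ℝ} {p : E} {ℓ : E →L[ℝ] ℝ} (hh : HasFDerivAt h ℓ p)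
    {δ : ℝ} (hδ : 0 < δ) :
    ∃ r > 0, ∀ z, ‖z‖ ≤ r → h (p + z) ≤ h p + ℓ z + δ * ‖z‖ := by
  have h2 := (hasFDerivAt_iff_isLittleO_nhds_zero.1 hh).def hδ
  obtain ⟨r, hr, hball⟩ := Metric.eventually_nhds_iff_ball.1 h2
  refine ⟨r / 2, by positivity, fun z hz ↦ ?_⟩
  have := hball z (by
    rw [Metric.mem_ball, dist_zero_right]
    linarith)
  rw [Real.norm_eq_abs] at this
  linarith [(abs_le.1 this).2]

/-- Near a hyperbolic equilibrium, the dissipation of the quadratic form persists for Lipschitz-small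
perturbations of the vector field. -/
theorem perturbed_hessian_dissipation {F₀ : E → E} {p : E} {L : E →L[ℝ] E}
    (hF₀ : HasStrictFDerivAt F₀ L p) {B : E →L[ℝ] E →L[ℝ] ℝ} {c : ℝ} (hc : 0 < c)
    (hdis : ∀ w, B w (L w) ≤ -(c * ‖w‖ ^ 2)) {ρ : ℝ} (hρ : ‖p‖ < ρ) :
    ∃ M > 0, ∃ η₀ > 0, ∃ ε₀ > 0, ∀ (F : E → E) (p' : E), ‖p' - p‖ ≤ η₀ → F p' = 0 →
      (∀ x ∈ Metric.ball (0 : E) ρ, ∀ y ∈ Metric.ball (0 : E) ρ,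
        ‖(F x - F₀ x) - (F y - F₀ y)‖ ≤ ε₀ * ‖x - y‖) →
      ∀ w, ‖w‖ ≤ η₀ → B w (F (p' + w)) ≤ -(c / 2 * ‖w‖ ^ 2) ∧ ‖F (p' + w)‖ ≤ M * ‖w‖ := by
  -- Chosen so that an error of size 2δ‖w‖ in the field costs at most half of the dissipation.
  set δ : ℝ := c / (4 * (‖B‖ + 1)) with hδ
  have hδ0 : 0 < δ := by positivity
  have hBδ : ‖B‖ * (2 * δ) ≤ c / 2 := by
    have : ‖B‖ * (2 * δ) = c / 2 * (‖B‖ / (‖B‖ + 1)) := by rw [hδ]; field_simp; ring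
    rw [this]
    have h1 : ‖B‖ / (‖B‖ + 1) ≤ 1 := (div_le_one (by positivity)).2 (by linarith)
    nlinarith
  have h1 := hF₀.isLittleO.def hδ0
  obtain ⟨r, hr, hball⟩ := Metric.eventually_nhds_iff_ball.1 h1
  refine ⟨‖L‖ + 2 * δ, by positivity, min (r / 3) ((ρ - ‖p‖) / 3),
    lt_min (by positivity) (by linarith), δ, hδ0, ?_⟩
  intro F p' hp' hFp' hLip w hw
  have hp1 := hp'.trans (min_le_left _ _)
  have hp2 := hp'.trans (min_le_right _ _)
  have hw1 := hw.trans (min_le_left _ _)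
  have hw2 := hw.trans (min_le_right _ _)
  have hpw : ‖p' + w - p‖ ≤ ‖p' - p‖ + ‖w‖ := by
    rw [add_sub_right_comm]
    exact norm_add_le _ _
  have hmem : ∀ x, ‖x - p‖ < ρ - ‖p‖ → x ∈ Metric.ball (0 : E) ρ := by
    intro x hx
    rw [mem_ball_zero_iff]
    have := norm_add_le (x - p) p
    rw [sub_add_cancel] at this
    linarith
  have h2 := hball (p' + w, p') (by
    rw [Metric.mem_ball, Prod.dist_eq, dist_eq_norm, dist_eq_norm]
    exact max_lt (by simp only; linarith) (by simp only; linarith))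
  simp only [add_sub_cancel_left] at h2
  have h3 := hLip (p' + w) (hmem _ (by linarith)) p' (hmem _ (by linarith))
  rw [add_sub_cancel_left, hFp'] at h3
  set e := F (p' + w) - L w with he
  have hee : ‖e‖ ≤ 2 * δ * ‖w‖ := by
    -- One share δ‖w‖ comes from the perturbation, the other from linearising the unperturbed field.
    -- Strict differentiability is needed since the increment is based at p' and not at `p`.
    have : e = (F (p' + w) - F₀ (p' + w) - (0 - F₀ p')) + (F₀ (p' + w) - F₀ p' - L w) := by
      rw [he]; abel
    rw [this]
    refine (norm_add_le _ _).trans ?_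
    linarith
  have hFe : F (p' + w) = L w + e := by rw [he]; abel
  rw [hFe]
  constructor
  · rw [map_add]
    have h4 : B w e ≤ ‖B‖ * ‖w‖ * ‖e‖ := (le_abs_self _).trans (B.le_opNorm₂ w e)
    have h5 : ‖B‖ * ‖w‖ * ‖e‖ ≤ ‖B‖ * ‖w‖ * (2 * δ * ‖w‖) := by gcongr
    have h6 : ‖B‖ * ‖w‖ * (2 * δ * ‖w‖) = ‖B‖ * (2 * δ) * ‖w‖ ^ 2 := by ring
    have h7 : ‖B‖ * (2 * δ) * ‖w‖ ^ 2 ≤ c / 2 * ‖w‖ ^ 2 := by gcongr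
    linarith [hdis w]
  · refine (norm_add_le _ _).trans ?_
    have := L.le_opNorm w
    linarith

/-- Persistence and local uniqueness of a nondegenerate equilibrium under Lipschitz-small
perturbations. -/
theorem exists_unique_perturbed_zero [FiniteDimensional ℝ E] {F₀ : E → E} {p : E}
    {L : E →L[ℝ] E} (hF₀ : HasStrictFDerivAt F₀ L p) (hL : Function.Injective L)
    (hp : F₀ p = 0) (h00 : F₀ 0 = 0) {ρ : ℝ} (hρ : ‖p‖ < ρ) :
    ∃ δ > 0, ∃ C > 0, ∃ ε₀ > 0, ∀ ε, 0 ≤ ε → ε ≤ ε₀ → ∀ F : E → E, F 0 = 0 →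
      (∀ x ∈ Metric.ball (0 : E) ρ, ∀ y ∈ Metric.ball (0 : E) ρ,
        ‖(F x - F₀ x) - (F y - F₀ y)‖ ≤ ε * ‖x - y‖) →
      ∃ p', ‖p' - p‖ ≤ C * ε ∧ F p' = 0 ∧ ∀ q, ‖q - p‖ ≤ δ → F q = 0 → q = p' := by
  obtain ⟨k, hk, hkL⟩ := exists_lower_bound hL
  have hcomp : CompleteSpace E := FiniteDimensional.complete ℝ E
  let Le : E ≃L[ℝ] E :=
    (LinearEquiv.ofInjectiveEndo (L : E →ₗ[ℝ] E) hL).toContinuousLinearEquiv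
  have hLe : ∀ w, Le w = L w := fun w ↦ rfl
  let inv : L.NonlinearRightInverse :=
    { toFun := Le.symm
      nnnorm := ⟨k⁻¹, by positivity⟩
      bound' := fun y ↦ by
        have := hkL (Le.symm y)
        rw [← hLe, Le.apply_symm_apply] at this
        change ‖Le.symm y‖ ≤ k⁻¹ * ‖y‖
        rwa [← div_eq_inv_mul, le_div_iff₀' hk]
      right_inv' := fun y ↦ by
        rw [← hLe]
        exact Le.apply_symm_apply y }
  have h1 := hF₀.isLittleO.def (show 0 < k / 4 by positivity)
  obtain ⟨r, hr, hball⟩ := Metric.eventually_nhds_iff_ball.1 h1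
  set δ := min (r / 2) ((ρ - ‖p‖) / 2) with hδ
  have hδ0 : 0 < δ := lt_min (by positivity) (by linarith)
  have hmem : ∀ x, ‖x - p‖ ≤ δ → x ∈ Metric.ball (0 : E) ρ := by
    intro x hx
    rw [mem_ball_zero_iff]
    have := norm_add_le (x - p) p
    rw [sub_add_cancel] at this
    have := hx.trans (min_le_right _ _)
    linarith
  have hC : 0 < 2 * (‖p‖ + 1) / k := by positivity
  refine ⟨δ, hδ0, 2 * (‖p‖ + 1) / k, hC, min (k / 4) (δ / (2 * (‖p‖ + 1) / k)),
    lt_min (by positivity) (by positivity), ?_⟩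
  intro ε hε0 hε F hF0 hLip
  have hε1 := hε.trans (min_le_left _ _)
  have hε2 := hε.trans (min_le_right _ _)
  rw [le_div_iff₀ hC] at hε2
  -- Half of the lower bound `k` of `L` is given away: k/4 to nonlinearity and k/4 to the
  -- perturbation. The remaining k/2 yields uniqueness and local surjectivity.
  have happ : ApproximatesLinearOn F L (Metric.closedBall p δ) ⟨k / 2, by positivity⟩ := by
    intro x hx y hy
    rw [mem_closedBall_iff_norm] at hx hy
    have h2 := hball (x, y) (by
      have := min_le_left (r / 2) ((ρ - ‖p‖) / 2)
      rw [Metric.mem_ball, Prod.dist_eq, dist_eq_norm, dist_eq_norm]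
      exact max_lt (by simp only; linarith) (by simp only; linarith))
    have h3 := hLip x (hmem x hx) y (hmem y hy)
    have h4 : F x - F y - L (x - y) =
        (F x - F₀ x - (F y - F₀ y)) + (F₀ x - F₀ y - L (x - y)) := by abel
    rw [h4]
    refine (norm_add_le _ _).trans ?_
    change _ ≤ k / 2 * ‖x - y‖
    simp only at h2
    have : ε * ‖x - y‖ ≤ k / 4 * ‖x - y‖ := by gcongr
    linarith
  have huniq : ∀ q q', ‖q - p‖ ≤ δ → ‖q' - p‖ ≤ δ → F q = 0 → F q' = 0 → q = q' := by
    intro q q' hq hq' hFq hFq'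
    have h2 := happ q (by rwa [mem_closedBall_iff_norm]) q' (by rwa [mem_closedBall_iff_norm])
    rw [hFq, hFq', sub_zero, zero_sub, norm_neg] at h2
    have h3 : ‖L (q - q')‖ ≤ k / 2 * ‖q - q'‖ := h2
    have h4 := hkL (q - q')
    have h5 : ‖q - q'‖ ≤ 0 := by
      by_contra! hpos
      nlinarith
    exact sub_eq_zero.1 (norm_le_zero_iff.1 h5)
  have hrad : 2 * (‖p‖ + 1) / k * ε ≤ δ := by linarith
  have hsurj := happ.surjOn_closedBall_of_nonlinearRightInverse inv (b := p)
    (ε := 2 * (‖p‖ + 1) / k * ε) (by positivity) (Metric.closedBall_subset_closedBall hrad)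
  have hFp : ‖F p‖ ≤ ε * ‖p‖ := by
    have := hLip p (by rw [mem_ball_zero_iff]; linarith) 0
      (by rw [mem_ball_zero_iff, norm_zero]; linarith [norm_nonneg p])
    simpa [hp, h00, hF0] using this
  -- The image of the ball of radius Cε about `p` covers radius (k/2)Cε = (‖p‖ + 1)ε about `F p`,
  -- and ‖F p‖ ≤ ε‖p‖ because the perturbation vanishes at 0.
  have hzero : (0 : E) ∈ Metric.closedBall (F p)
      ((((inv.nnnorm : ℝ))⁻¹ - (⟨k / 2, by positivity⟩ : NNReal)) *
        (2 * (‖p‖ + 1) / k * ε)) := by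
    rw [Metric.mem_closedBall, dist_zero_left]
    have : (((inv.nnnorm : ℝ))⁻¹ - (⟨k / 2, by positivity⟩ : NNReal)) *
        (2 * (‖p‖ + 1) / k * ε) = (‖p‖ + 1) * ε := by
      change ((k⁻¹)⁻¹ - k / 2) * _ = _
      rw [inv_inv]
      field_simp
      ring
    rw [this]
    nlinarith
  obtain ⟨p', hp', hFp'⟩ := hsurj hzero
  rw [mem_closedBall_iff_norm] at hp'
  exact ⟨p', hp', hFp', fun q hq hFq ↦ huniq q p' hq (hp'.trans hrad) hFq hFp'⟩

/-- On a compact set on which the origin is the only zero of `F`, and is nondegenerate, `‖F x‖`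
controls `‖x‖`. -/
theorem exists_lower_bound_on_compact [FiniteDimensional ℝ E] {F : E → E} {L : E →L[ℝ] E}
    (hF : HasFDerivAt F L 0) (hL : Function.Injective L) (hF0 : F 0 = 0) (hFc : Continuous F)
    {N : Set E} (hN : IsCompact N) (hzero : ∀ x ∈ N, F x = 0 → x = 0) :
    ∃ k > 0, ∀ x ∈ N, k * ‖x‖ ≤ ‖F x‖ := by
  obtain ⟨k, hk, hkL⟩ := exists_lower_bound hL
  have h1 := (hasFDerivAt_iff_isLittleO_nhds_zero.1 hF).def (show 0 < k / 2 by positivity)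
  obtain ⟨r, hr, hball⟩ := Metric.eventually_nhds_iff_ball.1 h1
  have hnear : ∀ x ∈ Metric.ball (0 : E) r, k / 2 * ‖x‖ ≤ ‖F x‖ := by
    intro x hx
    have h2 := hball x hx
    rw [zero_add, hF0, sub_zero] at h2
    have h3 := hkL x
    have h4 : ‖L x‖ ≤ ‖F x‖ + ‖F x - L x‖ := by
      have := norm_sub_le (F x) (F x - L x)
      simpa using this
    linarith
  have hN' : IsCompact (N \ Metric.ball (0 : E) r) := hN.diff Metric.isOpen_ball
  obtain ⟨D, hD⟩ := hN.isBounded.exists_norm_le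
  rcases (N \ Metric.ball (0 : E) r).eq_empty_or_nonempty with he | hne
  · exact ⟨k / 2, by positivity, fun x hx ↦ hnear x (by
      by_contra hx'
      have : x ∈ N \ Metric.ball (0 : E) r := ⟨hx, hx'⟩
      rw [he] at this
      exact this)⟩
  · obtain ⟨y, hy, hmin⟩ := hN'.exists_isMinOn hne hFc.norm.continuousOn
    have hy0 : 0 < ‖F y‖ := by
      refine norm_pos_iff.2 fun h ↦ hy.2 ?_
      rw [hzero y hy.1 h]
      exact Metric.mem_ball_self hr
    have hD1 : 0 < |D| + 1 := by positivity
    refine ⟨min (k / 2) (‖F y‖ / (|D| + 1)), lt_min (by positivity) (by positivity),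
      fun x hx ↦ ?_⟩
    by_cases hx' : x ∈ Metric.ball (0 : E) r
    · refine le_trans ?_ (hnear x hx')
      gcongr
      exact min_le_left _ _
    · have h5 : ‖F y‖ ≤ ‖F x‖ := hmin ⟨hx, hx'⟩
      have h6 : ‖x‖ ≤ |D| + 1 := (hD x hx).trans (by linarith [le_abs_self D])
      calc min (k / 2) (‖F y‖ / (|D| + 1)) * ‖x‖ ≤ ‖F y‖ / (|D| + 1) * (|D| + 1) := by
            gcongr
            exact min_le_right _ _
        _ = ‖F y‖ := by field_simp
        _ ≤ ‖F x‖ := h5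

end LocalEstimates

/-! ### From a mountain pass to a persistent connection. -/

section Connection

variable {E : Type*} [NormedAddCommGroup E] [NormedSpace ℝ E]

/-- `W` is a strict Lyapunov function for the vector field `F` on a neighbourhood of the region
`h ≤ 0`, whose boundary has height at least `W p`; the equilibrium `p` is a nondegenerate
mountain pass on that boundary, whose descending direction is transverse to it, and the origin is
the only equilibrium inside. -/
structure IsMountainPass (F : E → E) (W h : E → ℝ) (p : E) (R : ℝ) : Prop where
  contDiff_field : ContDiff ℝ 1 F
  contDiff_lyapunov : ContDiff ℝ 2 W
  contDiff_boundary : ContDiff ℝ 1 h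
  norm_lt : ∀ x, h x ≤ 0 → W x ≤ W p → ‖x‖ < R
  dissipation : ∃ c > 0, ∃ h₁ > 0, ∀ x, h x < h₁ → fderiv ℝ W x (F x) ≤ -(c * ‖F x‖ ^ 2)
  le_on_boundary : ∀ x, h x = 0 → W p ≤ W x
  eq_zero_of_inside : ∀ x, h x < 0 → F x = 0 → x = 0
  map_zero : F 0 = 0
  map_pass : F p = 0
  zero_inside : h 0 < 0
  pass_on_boundary : h p = 0
  zero_lt_pass : W 0 < W p
  injective_zero : Function.Injective (fderiv ℝ F 0)
  injective_pass : Function.Injective (fderiv ℝ F p)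
  critical_zero : fderiv ℝ W 0 = 0
  critical_pass : fderiv ℝ W p = 0
  descending : ∃ v, fderiv ℝ (fderiv ℝ W) p v v < 0
  transverse : ∃ c > 0, ∃ C > 0, ∀ w,
    c * ‖w‖ ^ 2 ≤ fderiv ℝ (fderiv ℝ W) p w w + C * (fderiv ℝ h p w) ^ 2

namespace IsMountainPass

variable {F₀ : E → E} {W h : E → ℝ} {p : E} {R : ℝ}

theorem differentiable_lyapunov (H : IsMountainPass F₀ W h p R) : Differentiable ℝ W :=
  H.contDiff_lyapunov.differentiable (by simp)

theorem contDiff_fderiv_lyapunov (H : IsMountainPass F₀ W h p R) : ContDiff ℝ 1 (fderiv ℝ W) :=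
  H.contDiff_lyapunov.fderiv_right (by norm_num)

theorem hasFDerivAt_fderiv (H : IsMountainPass F₀ W h p R) (x : E) :
    HasFDerivAt (fderiv ℝ W) (fderiv ℝ (fderiv ℝ W) x) x :=
  (H.contDiff_fderiv_lyapunov.differentiable (by simp) x).hasFDerivAt

theorem hasStrictFDerivAt (H : IsMountainPass F₀ W h p R) (x : E) :
    HasStrictFDerivAt F₀ (fderiv ℝ F₀ x) x :=
  H.contDiff_field.contDiffAt.hasStrictFDerivAt (by simp)

theorem hessian_symm (H : IsMountainPass F₀ W h p R) (v w : E) :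
    fderiv ℝ (fderiv ℝ W) p v w = fderiv ℝ (fderiv ℝ W) p w v :=
  (H.contDiff_lyapunov.contDiffAt.isSymmSndFDerivAt (by simp)) v w

theorem norm_pass_lt (H : IsMountainPass F₀ W h p R) : ‖p‖ < R :=
  H.norm_lt p H.pass_on_boundary.le le_rfl

/-- Linearising the dissipation inequality bounds the form by -c‖Lw‖², and nondegeneracy of the pass
turns ‖Lw‖ into ‖w‖. -/
theorem exists_hessian_dissipation [FiniteDimensional ℝ E] (H : IsMountainPass F₀ W h p R) :
    ∃ c > 0, ∀ w, fderiv ℝ (fderiv ℝ W) p w (fderiv ℝ F₀ p w) ≤ -(c * ‖w‖ ^ 2) := by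
  obtain ⟨c, hc, h₁, hh₁, hdis⟩ := H.dissipation
  obtain ⟨k, hk, hkL⟩ := exists_lower_bound H.injective_pass
  refine ⟨c * k ^ 2, by positivity, fun w ↦ ?_⟩
  have hev : ∀ᶠ x in 𝓝 p, fderiv ℝ W x (F₀ x) ≤ -(c * ‖F₀ x‖ ^ 2) := by
    have : ∀ᶠ x in 𝓝 p, h x < h₁ :=
      H.contDiff_boundary.continuous.continuousAt.eventually_lt continuousAt_const
        (by rwa [H.pass_on_boundary])
    exact this.mono hdis
  refine (hessian_dissipation (H.hasStrictFDerivAt p).hasFDerivAt (H.hasFDerivAt_fderiv p)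
    H.map_pass H.critical_pass hev w).trans (neg_le_neg ?_)
  rw [mul_assoc, ← mul_pow]
  have := hkL w
  gcongr

/-- Below the pass, inside the region, the Lyapunov function is dissipated uniformly, also under
small perturbations. -/
theorem exists_uniform_dissipation [FiniteDimensional ℝ E] (H : IsMountainPass F₀ W h p R)
    {w₁ : ℝ} (hw₁ : w₁ < W p) :
    ∃ c > 0, ∃ ε₀ > 0, ∀ F : E → E, F 0 = 0 →
      (∀ x ∈ Metric.ball (0 : E) (R + 1), ∀ y ∈ Metric.ball (0 : E) (R + 1),
        ‖(F x - F₀ x) - (F y - F₀ y)‖ ≤ ε₀ * ‖x - y‖) →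
      ∀ x, h x ≤ 0 → W x ≤ w₁ → fderiv ℝ W x (F x) ≤ -(c * ‖x‖ ^ 2) := by
  have : ProperSpace E := FiniteDimensional.proper_real E
  obtain ⟨c, hc, h₁, hh₁, hdis⟩ := H.dissipation
  have hinside : ∀ x, h x ≤ 0 → W x ≤ w₁ → h x < 0 := fun x hx hx' ↦
    lt_of_le_of_ne hx fun he ↦ by linarith [H.le_on_boundary x he]
  have hR : 0 < R := (norm_nonneg p).trans_lt H.norm_pass_lt
  have hNb : {x | h x ≤ 0 ∧ W x ≤ w₁} ⊆ Metric.closedBall 0 R := fun x hx ↦ by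
    rw [mem_closedBall_zero_iff]
    exact (H.norm_lt x hx.1 (hx.2.trans hw₁.le)).le
  have hcl1 : IsClosed {x | h x ≤ 0} :=
    isClosed_le H.contDiff_boundary.continuous continuous_const
  have hcl2 : IsClosed {x | W x ≤ w₁} :=
    isClosed_le H.contDiff_lyapunov.continuous continuous_const
  have hN : IsCompact {x | h x ≤ 0 ∧ W x ≤ w₁} :=
    (isCompact_closedBall (0 : E) R).of_isClosed_subset (hcl1.inter hcl2) hNb
  obtain ⟨k, hk, hkF⟩ := exists_lower_bound_on_compact (H.hasStrictFDerivAt 0).hasFDerivAt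
    H.injective_zero H.map_zero H.contDiff_field.continuous hN
    (fun x hx ↦ H.eq_zero_of_inside x (hinside x hx.1 hx.2))
  obtain ⟨K, hK⟩ := (H.contDiff_fderiv_lyapunov.contDiffOn
    (s := Metric.closedBall (0 : E) R)).exists_lipschitzOnWith (by simp)
    (convex_closedBall 0 R) (isCompact_closedBall 0 R)
  have hKpos : (0 : ℝ) < K + 1 := by positivity
  -- The differential of `W` and the perturbation both vanish at 0, so their product is quadratic in
  -- ‖x‖; this ε₀ makes it cost at most half of the dissipation ck²‖x‖².
  refine ⟨c * k ^ 2 / 2, by positivity, c * k ^ 2 / (2 * (K + 1)), by positivity, ?_⟩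
  intro F hF0 hLip x hx hx'
  have hxR : ‖x‖ ≤ R := by simpa using hNb ⟨hx, hx'⟩
  have h1 : ‖fderiv ℝ W x‖ ≤ K * ‖x‖ := by
    have := hK.norm_sub_le (x := x) (y := 0) (by simpa using hxR) (by simpa using hR.le)
    simpa [H.critical_zero] using this
  have h2 : ‖F x - F₀ x‖ ≤ c * k ^ 2 / (2 * (K + 1)) * ‖x‖ := by
    have := hLip x (by rw [mem_ball_zero_iff]; linarith) 0
      (by rw [mem_ball_zero_iff, norm_zero]; linarith)
    simpa [hF0, H.map_zero] using this
  have h3 : fderiv ℝ W x (F x - F₀ x) ≤ c * k ^ 2 / 2 * ‖x‖ ^ 2 := by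
    calc fderiv ℝ W x (F x - F₀ x) ≤ ‖fderiv ℝ W x (F x - F₀ x)‖ := le_abs_self _
      _ ≤ ‖fderiv ℝ W x‖ * ‖F x - F₀ x‖ := ContinuousLinearMap.le_opNorm _ _
      _ ≤ ((K + 1) * ‖x‖) * (c * k ^ 2 / (2 * (K + 1)) * ‖x‖) := by
          have : K * ‖x‖ ≤ (K + 1) * ‖x‖ := by gcongr; linarith
          gcongr
          exact h1.trans this
      _ = c * k ^ 2 / 2 * ‖x‖ ^ 2 := by field_simp
  have h4 := hdis x (hx.trans_lt hh₁)
  have h5 : (k * ‖x‖) ^ 2 ≤ ‖F₀ x‖ ^ 2 := by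
    have := hkF x ⟨hx, hx'⟩
    gcongr
  have h6 : fderiv ℝ W x (F x) = fderiv ℝ W x (F₀ x) + fderiv ℝ W x (F x - F₀ x) := by
    rw [← map_add]
    congr 1
    abel
  rw [h6]
  nlinarith

/-- The unstable orbits of all nearby equilibria of nearby vector fields reach the same region
below the pass. -/
theorem exists_descent [FiniteDimensional ℝ E] (H : IsMountainPass F₀ W h p R) :
    ∃ κ > 0, ∃ ε₀ > 0, ∀ (F : E → E) (p' : E),
      ContDiffOn ℝ 1 F (Metric.ball 0 (R + 1)) → ‖p' - p‖ ≤ ε₀ → F p' = 0 →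
      (∀ x ∈ Metric.ball (0 : E) (R + 1), ∀ y ∈ Metric.ball (0 : E) (R + 1),
        ‖(F x - F₀ x) - (F y - F₀ y)‖ ≤ ε₀ * ‖x - y‖) →
      ∃ (G : E → E) (u : ℝ → E), (∀ x, ‖x‖ ≤ R → G x = F x) ∧ Continuous G ∧
        (∀ t, HasDerivAt u (G (u t)) t) ∧ Tendsto u atBot (𝓝 p') ∧ (∀ t ≤ 0, ‖u t‖ ≤ R) ∧
        h (u 0) ≤ 0 ∧ W (u 0) ≤ W p - κ := by
  obtain ⟨c, hc, hBL⟩ := H.exists_hessian_dissipation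
  obtain ⟨M, hM, η₀, hη₀, ε₁, hε₁, hpert⟩ := perturbed_hessian_dissipation
    (H.hasStrictFDerivAt p) hc hBL (ρ := R + 1) (by linarith [H.norm_pass_lt])
  obtain ⟨c₂, hc₂, C₂, hC₂, hcone⟩ := H.transverse
  obtain ⟨v₀, hv₀⟩ := H.descending
  set B := fderiv ℝ (fderiv ℝ W) p with hB
  -- The sign makes positive `ℓ` point into the region h ≤ 0.
  set ℓ : E →L[ℝ] ℝ := -fderiv ℝ h p with hℓ
  have hcone' : ∀ w, B w w ≤ 0 → Real.sqrt (c₂ / C₂) * ‖w‖ ≤ |ℓ w| := by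
    intro w hw
    have h1 := hcone w
    have h2 : (ℓ w) ^ 2 = (fderiv ℝ h p w) ^ 2 := by simp [hℓ]
    refine abs_le_of_sq_le_sq' ?_ (abs_nonneg _) |>.2
    rw [mul_pow, Real.sq_sqrt (by positivity), sq_abs, h2, div_mul_eq_mul_div, div_le_iff₀ hC₂]
    linarith
  set c₃ := Real.sqrt (c₂ / C₂) with hc₃
  have hc₃0 : 0 < c₃ := Real.sqrt_pos.2 (by positivity)
  have hne : ∀ w, w ≠ 0 → B w w ≤ 0 → ℓ w ≠ 0 := by
    intro w hw hBw h0
    have h1 := hcone' w hBw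
    rw [h0, abs_zero] at h1
    have : 0 < c₃ * ‖w‖ := mul_pos hc₃0 (norm_pos_iff.2 hw)
    linarith
  -- The cone is symmetric under w ↦ -w, so a descending direction or its negative points inwards.
  obtain ⟨v, hv, hℓv⟩ : ∃ v, B v v < 0 ∧ 0 < ℓ v := by
    have hv00 : v₀ ≠ 0 := by
      rintro rfl
      simp at hv₀
    rcases lt_or_gt_of_ne (hne v₀ hv00 hv₀.le) with h1 | h1
    · exact ⟨-v₀, by simpa using hv₀, by simpa using h1⟩
    · exact ⟨v₀, hv₀, h1⟩
  set c' := c / 2 / (4 * M) with hc'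
  have hc'0 : 0 < c' := by positivity
  obtain ⟨r₁, hr₁, htaylor⟩ := taylor_estimate H.hessian_symm H.differentiable_lyapunov
    (H.hasFDerivAt_fderiv p) H.critical_pass (show 0 < c' / 32 by positivity)
  obtain ⟨r₂, hr₂, hfirst⟩ := first_order_estimate
    (H.contDiff_boundary.differentiable (by simp) p).hasFDerivAt (show 0 < c₃ / 8 by positivity)
  have hRp : 0 < R - ‖p‖ := by linarith [H.norm_pass_lt]
  obtain ⟨η, hη, hηη₀, hηr₁, hηr₂, hηR⟩ : ∃ η > 0, η ≤ η₀ ∧ 2 * η ≤ r₁ ∧ 2 * η ≤ r₂ ∧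
      2 * η ≤ R - ‖p‖ := by
    refine ⟨min η₀ (min (r₁ / 2) (min (r₂ / 2) ((R - ‖p‖) / 2))), by positivity,
      min_le_left _ _, ?_, ?_, ?_⟩
    · linarith [(min_le_right η₀ _).trans (min_le_left (r₁ / 2) (min (r₂ / 2) ((R - ‖p‖) / 2)))]
    · linarith [((min_le_right η₀ _).trans (min_le_right (r₁ / 2)
        (min (r₂ / 2) ((R - ‖p‖) / 2)))).trans (min_le_left _ _)]
    · linarith [((min_le_right η₀ _).trans (min_le_right (r₁ / 2)
        (min (r₂ / 2) ((R - ‖p‖) / 2)))).trans (min_le_right _ _)]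
  obtain ⟨e, he, heε₁, heη, heB, heℓ⟩ : ∃ e > 0, e ≤ ε₁ ∧ e ≤ η ∧ ‖B‖ * e ≤ c' * η / 12 ∧
      ‖ℓ‖ * e ≤ c₃ * η / 4 := by
    refine ⟨min ε₁ (min η (min (c' * η / 12 / (‖B‖ + 1)) (c₃ * η / 4 / (‖ℓ‖ + 1)))),
      by positivity, min_le_left _ _, (min_le_right _ _).trans (min_le_left _ _), ?_, ?_⟩
    · have h1 := ((min_le_right ε₁ _).trans (min_le_right η _)).trans
        (min_le_left (c' * η / 12 / (‖B‖ + 1)) (c₃ * η / 4 / (‖ℓ‖ + 1)))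
      calc ‖B‖ * _ ≤ (‖B‖ + 1) * (c' * η / 12 / (‖B‖ + 1)) := by
            gcongr
            linarith
        _ = c' * η / 12 := by field_simp
    · have h1 := ((min_le_right ε₁ _).trans (min_le_right η _)).trans
        (min_le_right (c' * η / 12 / (‖B‖ + 1)) (c₃ * η / 4 / (‖ℓ‖ + 1)))
      calc ‖ℓ‖ * _ ≤ (‖ℓ‖ + 1) * (c₃ * η / 4 / (‖ℓ‖ + 1)) := by
            gcongr
            linarith
        _ = c₃ * η / 4 := by field_simp
  -- At exit the form is at most -c'η², lowering `W` by c'η²/2. The Taylor remainder and the shift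
  -- from `p` to p' each consume at most c'η²/8, which leaves c'η²/4.
  refine ⟨c' * η ^ 2 / 4, by positivity, e, he, ?_⟩
  intro F p' hF hp' hFp' hLip
  have hR : 0 < R := (norm_nonneg p).trans_lt H.norm_pass_lt
  obtain ⟨G, K, M', hGL, hGM, hGF⟩ := exists_cutoff hR hF
  have hcomp : CompleteSpace E := FiniteDimensional.complete ℝ E
  have hpw : ∀ w, ‖w‖ ≤ η → ‖p' + w‖ ≤ R := by
    intro w hw
    have h1 : p' + w = p + (p' - p) + w := by abel
    rw [h1]
    have h2 := norm_add_le (p + (p' - p)) w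
    have h3 := norm_add_le p (p' - p)
    linarith
  have hpert' := hpert F p' (hp'.trans (heη.trans hηη₀)) hFp'
    (fun x hx y hy ↦ (hLip x hx y hy).trans (by gcongr))
  have hGw : ∀ w, ‖w‖ ≤ η → G (p' + w) = F (p' + w) := fun w hw ↦ hGF _ (hpw w hw)
  have hGp' : G p' = 0 := by
    have := hGw 0 (by simpa using hη.le)
    rwa [add_zero, hFp'] at this
  obtain ⟨u, hu, hlim, hback, hu0, hℓ0, hB0⟩ := exists_unstable_orbit hGL
    (exists_global_solution hGL hGM) hGp' H.hessian_symm (c := c / 2) (by positivity) hη hM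
    (fun w hw ↦ by rw [hGw w hw]; exact (hpert' w (hw.trans hηη₀)).1)
    (fun w hw ↦ by
      rw [hGw w hw]
      exact (hpert' w (hw.trans hηη₀)).2.trans (by gcongr))
    hne hv hℓv
  refine ⟨G, u, hGF, hGL.continuous, hu, hlim, fun t ht ↦ ?_, ?_, ?_⟩
  · have := hpw _ (hback t ht)
    rwa [add_sub_cancel] at this
  all_goals
    set w := u 0 - p' with hw
    set d := p' - p with hd
    have hu0' : u 0 = p + (w + d) := by rw [hw, hd]; abel
    have hz : ‖w + d‖ ≤ 2 * η := (norm_add_le _ _).trans (by linarith)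
    rw [hu0']
  · have h1 := hfirst (w + d) (hz.trans hηr₂)
    have h2 : fderiv ℝ h p (w + d) = -ℓ w - ℓ d := by simp [hℓ]
    have h3 : |ℓ d| ≤ ‖ℓ‖ * e := (ℓ.le_opNorm d).trans (by gcongr)
    have h4 := hcone' w (hB0.trans (by
      have : 0 ≤ c / 2 / (4 * M) * η ^ 2 := by positivity
      linarith))
    rw [abs_of_nonneg hℓ0, hu0] at h4
    rw [H.pass_on_boundary, h2] at h1
    have h5 : c₃ / 8 * ‖w + d‖ ≤ c₃ / 8 * (2 * η) := by gcongr
    have h6 := neg_abs_le (ℓ d)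
    have h7 : 0 < c₃ * η := by positivity
    linarith
  · have h1 := htaylor (w + d) (hz.trans hηr₁)
    have h2 : B (w + d) (w + d) = B w w + 2 * B w d + B d d := by
      simp only [map_add, add_apply]
      rw [H.hessian_symm d w]
      ring
    have h3 : B w d ≤ ‖B‖ * η * e := by
      refine (le_abs_self _).trans ((B.le_opNorm₂ w d).trans ?_)
      rw [hu0]
      gcongr
    have h4 : B d d ≤ ‖B‖ * η * e := by
      refine (le_abs_self _).trans ((B.le_opNorm₂ d d).trans ?_)
      gcongr
      exact hp'.trans heη
    have h5 : c' / 32 * ‖w + d‖ ^ 2 ≤ c' / 32 * (2 * η) ^ 2 := by gcongr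
    have h6 : ‖B‖ * η * e ≤ c' * η ^ 2 / 12 := by
      calc ‖B‖ * η * e = ‖B‖ * e * η := by ring
        _ ≤ c' * η / 12 * η := by gcongr
        _ = c' * η ^ 2 / 12 := by ring
    rw [h2] at h1
    linarith

/-- A mountain pass is connected to the origin, and the connection persists under small
perturbations of the vector field. -/
theorem exists_connection [FiniteDimensional ℝ E] (H : IsMountainPass F₀ W h p R) :
    ∃ δ > 0, ∃ C > 0, ∃ ε₀ > 0, ∀ ε, 0 ≤ ε → ε ≤ ε₀ → ∀ F : E → E,
      ContDiffOn ℝ 1 F (Metric.ball 0 (R + 1)) → F 0 = 0 →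
      (∀ x ∈ Metric.ball (0 : E) (R + 1), ∀ y ∈ Metric.ball (0 : E) (R + 1),
        ‖(F x - F₀ x) - (F y - F₀ y)‖ ≤ ε * ‖x - y‖) →
      ∃ p', ‖p' - p‖ ≤ C * ε ∧ F p' = 0 ∧ (∀ q, ‖q - p‖ ≤ δ → F q = 0 → q = p') ∧
        ∃ u, IsHeteroclinic F p' 0 u := by
  have : ProperSpace E := FiniteDimensional.proper_real E
  obtain ⟨δ, hδ, C, hC, ε₁, hε₁, hzero⟩ := exists_unique_perturbed_zero (H.hasStrictFDerivAt p)
    H.injective_pass H.map_pass H.map_zero (ρ := R + 1) (by linarith [H.norm_pass_lt])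
  obtain ⟨κ, hκ, ε₂, hε₂, hdesc⟩ := H.exists_descent
  -- A level above both the origin and the end of the descent, yet strictly below the pass.
  set w₁ := max (W p - κ) ((W 0 + W p) / 2) with hw₁
  have hW0p := H.zero_lt_pass
  have hw₁p : w₁ < W p := max_lt (by linarith) (by linarith)
  have hw₁0 : W 0 < w₁ := lt_of_lt_of_le (by linarith) (le_max_right _ _)
  obtain ⟨c, hc, ε₃, hε₃, hdis⟩ := H.exists_uniform_dissipation hw₁p
  have hp0 : 0 < ‖p‖ := by
    refine norm_pos_iff.2 fun h0 ↦ ?_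
    have := H.pass_on_boundary
    rw [h0] at this
    linarith [H.zero_inside]
  -- The bound ε₂ / C brings p' close enough to `p` for the descent, and ‖p‖ / (2C) keeps p' away
  -- from the origin.
  refine ⟨δ, hδ, C, hC, min ε₁ (min ε₂ (min ε₃ (min (ε₂ / C) (‖p‖ / (2 * C))))),
    by positivity, ?_⟩
  intro ε hε0 hε F hF hF0 hLip
  obtain ⟨hεa, hε⟩ := le_min_iff.1 hε
  obtain ⟨hεb, hε⟩ := le_min_iff.1 hε
  obtain ⟨hεc, hε⟩ := le_min_iff.1 hε
  obtain ⟨hεd, hεe⟩ := le_min_iff.1 hε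
  rw [le_div_iff₀ hC] at hεd
  rw [le_div_iff₀ (by positivity)] at hεe
  obtain ⟨p', hp', hFp', huniq⟩ := hzero ε hε0 hεa F hF0 hLip
  refine ⟨p', hp', hFp', huniq, ?_⟩
  obtain ⟨G, u, hGF, hGc, hu, hbot, hback, hu0, hu1⟩ := hdesc F p' hF (by linarith) hFp'
    (fun x hx y hy ↦ (hLip x hx y hy).trans (by gcongr))
  have hdis' := hdis F hF0 (fun x hx y hy ↦ (hLip x hx y hy).trans (by gcongr))
  have hNR : ∀ x, h x ≤ 0 → W x ≤ w₁ → ‖x‖ ≤ R := fun x hx hx' ↦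
    (H.norm_lt x hx (hx'.trans hw₁p.le)).le
  have hneg : ∀ x, h x ≤ 0 → W x ≤ w₁ → h x < 0 := fun x hx hx' ↦
    lt_of_le_of_ne hx fun he ↦ by linarith [H.le_on_boundary x he]
  have hdisG : ∀ x, h x ≤ 0 → W x ≤ w₁ → fderiv ℝ W x (G x) ≤ -(c * ‖x‖ ^ 2) := by
    intro x hx hx'
    rw [hGF x (hNR x hx hx')]
    exact hdis' x hx hx'
  obtain ⟨M, hM⟩ := (isCompact_closedBall (0 : E) R).exists_bound_of_continuousOn
    hGc.continuousOn
  obtain ⟨b, hb⟩ := (isCompact_closedBall (0 : E) R).exists_bound_of_continuousOn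
    H.contDiff_lyapunov.continuous.continuousOn
  have hu1' : W (u 0) ≤ w₁ := hu1.trans (le_max_left _ _)
  have htop : Tendsto u atTop (𝓝 0) := by
    refine tendsto_zero_of_trapping H.differentiable_lyapunov H.contDiff_boundary.continuous hc
      (M := |M| + 1) (b := -b) (by positivity) hneg hdisG hw₁0 (fun x hx hx' ↦ ?_)
      (fun x hx hx' ↦ ?_) hu hu0 hu1'
    · have := hM x (by simpa using hNR x hx hx')
      linarith [le_abs_self M]
    · have := hb x (by simpa using hNR x hx hx')
      exact (abs_le.1 this).1
  have huR : ∀ t, ‖u t‖ ≤ R := by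
    intro t
    rcases le_total t 0 with ht | ht
    · exact hback t ht
    · have := mem_of_trapping H.differentiable_lyapunov H.contDiff_boundary.continuous hc hneg
        hdisG hw₁0 hu hu0 hu1' ht
      exact hNR _ this.1 this.2
  refine ⟨u, hFp', hF0, fun h0 ↦ ?_, fun t ↦ ?_, hbot, htop⟩
  · rw [h0, zero_sub, norm_neg] at hp'
    linarith
  · rw [← hGF _ (huR t)]
    exact hu t

end IsMountainPass

end Connection

/-! ### Higher-order terms as Lipschitz-small perturbations; inherited symmetry. -/

theorem eventually_mul_lt (a : ℝ) {b : ℝ} (hb : 0 < b) : ∀ᶠ ε in 𝓝[>] (0 : ℝ), a * ε < b := by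
  have h : Tendsto (fun ε : ℝ ↦ a * ε) (𝓝 0) (𝓝 (a * 0)) :=
    (continuous_const.mul continuous_id).tendsto 0
  rw [mul_zero] at h
  exact (h.mono_left nhdsWithin_le_nhds).eventually_lt_const hb

/-- Perturbation size 0 forces p' = p and gives the leading-order orbit; a C¹ bound of order ε on a
ball is a Lipschitz bound of order ε. The map `S` stands for a reflection fixing `A`: it sends the
perturbed equilibrium to one no farther from `A`, so local uniqueness makes it a fixed point of `S`,
and `hshape` reads off the shape. -/
theorem connectsToTrivial_of_isMountainPass {E : Type*} [NormedAddCommGroup E] [NormedSpace ℝ E]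
    [FiniteDimensional ℝ E] {F : (E → ℝ × ℝ) → E → E} {embed : ℝ × ℝ → E}
    (hembed₀ : embed 0 = 0) (hembed : ∀ A A', ‖embed A' - embed A‖ = ‖A' - A‖)
    (T : ℝ × ℝ →L[ℝ] E) (hF : ∀ r x, F r x = F 0 x + T (r x))
    (hzero : ∀ r x, F r x = 0 → ∃ A, x = embed A)
    {W h : E → ℝ} {A : ℝ × ℝ} {R : ℝ} (H : IsMountainPass (F 0) W h (embed A) R)
    {sym : (E → ℝ × ℝ) → Prop} {shape : ℝ × ℝ → Prop} (S : ℝ × ℝ → ℝ × ℝ)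
    (hS : ∀ A', ‖S A' - A‖ ≤ ‖A' - A‖)
    (hsym : ∀ r, sym r → ∀ A', F r (embed A') = 0 → F r (embed (S A')) = 0)
    (hshape : ∀ A', S A' = A' → A'.1 ≠ 0 → shape A') (hA : A.1 ≠ 0) :
    ConnectsToTrivial F embed sym shape A := by
  obtain ⟨δ, hδ, C, hC, ε₀, hε₀, hconn⟩ := H.exists_connection
  refine ⟨?_, fun r hr ↦ ?_⟩
  · obtain ⟨p', hp', -, -, hu⟩ := hconn 0 le_rfl hε₀.le (F 0) H.contDiff_field.contDiffOn
      H.map_zero (fun x _ y _ ↦ by simp)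
    rw [mul_zero] at hp'
    rw [sub_eq_zero.1 (norm_le_zero_iff.1 hp')] at hu
    rwa [hembed₀]
  · obtain ⟨D, hD⟩ := hr.isBigO (R + 1) (by
      linarith [(norm_nonneg (embed A)).trans_lt H.norm_pass_lt])
    set k := ‖T‖ * max D 0 with hk
    have hk0 : 0 ≤ k := by positivity
    refine ⟨C * k, ?_⟩
    filter_upwards [hD, hr.map_zero, self_mem_nhdsWithin, eventually_mul_lt k hε₀,
      eventually_mul_lt (C * k) hδ, eventually_mul_lt (C * k) (abs_pos.2 hA)] with ε hε hr0 hεpos h1 h2 h3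
    have hε0 : (0 : ℝ) < ε := hεpos
    have hFr : F (r ε) = fun x ↦ F 0 x + T (r ε x) := funext (hF (r ε))
    have hlip : ∀ x ∈ Metric.ball (0 : E) (R + 1), ∀ y ∈ Metric.ball (0 : E) (R + 1),
        ‖(F (r ε) x - F 0 x) - (F (r ε) y - F 0 y)‖ ≤ k * ε * ‖x - y‖ := by
      intro x hx y hy
      have h4 : ‖r ε x - r ε y‖ ≤ max D 0 * ε * ‖x - y‖ := by
        refine (convex_ball (0 : E) (R + 1)).norm_image_sub_le_of_norm_fderiv_le
          (𝕜 := ℝ) (fun z hz ↦ ?_) (fun z hz ↦ ?_) hy hx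
        · exact (hε.1.contDiffAt (Metric.isOpen_ball.mem_nhds hz)).differentiableAt (by simp)
        · refine (hε.2 z hz).2.trans ?_
          gcongr
          exact le_max_left _ _
      rw [hF (r ε) x, hF (r ε) y, add_sub_cancel_left, add_sub_cancel_left, ← map_sub]
      refine (T.le_opNorm _).trans ?_
      calc ‖T‖ * ‖r ε x - r ε y‖ ≤ ‖T‖ * (max D 0 * ε * ‖x - y‖) := by gcongr
        _ = k * ε * ‖x - y‖ := by rw [hk]; ring
    obtain ⟨p', hp', hFp', huniq, u, hu⟩ := hconn (k * ε) (by positivity) h1.le (F (r ε))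
      (by
        rw [hFr]
        exact H.contDiff_field.contDiffOn.add (T.contDiff.comp_contDiffOn hε.1))
      (by rw [hF, hr0, H.map_zero, map_zero, add_zero]) hlip
    obtain ⟨A', rfl⟩ := hzero _ _ hFp'
    rw [hembed, ← mul_assoc] at hp'
    refine ⟨A', hp', fun hs ↦ hshape A' ?_ ?_, u, by rwa [hembed₀]⟩
    · have h5 := huniq _ (by
        rw [hembed]
        exact ((hS A').trans hp').trans h2.le) (hsym _ hs A' hFp')
      rw [← sub_eq_zero, ← norm_le_zero_iff, ← hembed, h5, sub_self, norm_zero]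
    · intro h0
      have h6 : ‖(A' - A).1‖ ≤ ‖A' - A‖ := norm_fst_le _
      rw [Prod.fst_sub, h0, zero_sub, norm_neg, Real.norm_eq_abs] at h6
      linarith

/-! ### Geometry of the quartic potential at squares and rolls. -/

/-- The potential of the amplitude equations. -/
noncomputable def potential (μ₀ K₀ K₁ x y : ℝ) : ℝ :=
  μ₀ / 2 * (x ^ 2 + y ^ 2) + K₀ / 4 * (x ^ 4 + y ^ 4) + K₁ / 2 * (x ^ 2 * y ^ 2)

/-- The derivative of the potential with respect to its first amplitude. -/
def force (μ₀ K₀ K₁ x y : ℝ) : ℝ := μ₀ * x + (K₀ * x ^ 2 + K₁ * y ^ 2) * x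

theorem hasDerivAt_force (μ₀ K₀ K₁ : ℝ) {a b : ℝ → ℝ} {a' b' t : ℝ} (ha : HasDerivAt a a' t)
    (hb : HasDerivAt b b' t) :
    HasDerivAt (fun s ↦ force μ₀ K₀ K₁ (a s) (b s))
      ((μ₀ + 3 * K₀ * a t ^ 2 + K₁ * b t ^ 2) * a' + 2 * K₁ * a t * b t * b') t := by
  have h := (ha.const_mul μ₀).add
    ((((ha.pow 2).const_mul K₀).add ((hb.pow 2).const_mul K₁)).mul ha)
  convert! h using 1
  simp only [Pi.add_apply, Pi.pow_apply]
  ring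

theorem hasDerivAt_potential (μ₀ K₀ K₁ : ℝ) {a b : ℝ → ℝ} {a' b' t : ℝ}
    (ha : HasDerivAt a a' t) (hb : HasDerivAt b b' t) :
    HasDerivAt (fun s ↦ potential μ₀ K₀ K₁ (a s) (b s))
      (force μ₀ K₀ K₁ (a t) (b t) * a' + force μ₀ K₀ K₁ (b t) (a t) * b') t := by
  have h := ((((ha.pow 2).add (hb.pow 2)).const_mul (μ₀ / 2)).add
    (((ha.pow 4).add (hb.pow 4)).const_mul (K₀ / 4))).add
    (((ha.pow 2).mul (hb.pow 2)).const_mul (K₁ / 2))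
  convert! h using 1
  simp only [Pi.pow_apply, force]
  ring

/-- The geometry of the potential at a mountain pass `(x₀, y₀)`: on the circle through this
critical point the excess height controls the force, inside this circle the origin is the only
critical point, and the Hessian has the eigenvectors `(x₀, y₀)` and `(-y₀, x₀)`. -/
structure IsPass (μ₀ K₀ K₁ Λ x₀ y₀ : ℝ) : Prop where
  gap_pos : 0 < Λ
  radius_pos : 0 < x₀ ^ 2 + y₀ ^ 2
  height_pos : 0 < potential μ₀ K₀ K₁ x₀ y₀
  force_fst : force μ₀ K₀ K₁ x₀ y₀ = 0
  force_snd : force μ₀ K₀ K₁ y₀ x₀ = 0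
  circle : ∀ x y, x ^ 2 + y ^ 2 = x₀ ^ 2 + y₀ ^ 2 →
    force μ₀ K₀ K₁ x y ^ 2 + force μ₀ K₀ K₁ y x ^ 2 =
      2 * (x₀ ^ 2 + y₀ ^ 2) * Λ * (potential μ₀ K₀ K₁ x y - potential μ₀ K₀ K₁ x₀ y₀)
  inside : ∀ x y, x ^ 2 + y ^ 2 < x₀ ^ 2 + y₀ ^ 2 → force μ₀ K₀ K₁ x y = 0 →
    force μ₀ K₀ K₁ y x = 0 → x = 0 ∧ y = 0
  hessian : ∀ a b,
    ((μ₀ + 3 * K₀ * x₀ ^ 2 + K₁ * y₀ ^ 2) * a + 2 * K₁ * x₀ * y₀ * b) * a +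
      ((μ₀ + 3 * K₀ * y₀ ^ 2 + K₁ * x₀ ^ 2) * b + 2 * K₁ * y₀ * x₀ * a) * b =
      Λ * (x₀ ^ 2 + y₀ ^ 2) * (a ^ 2 + b ^ 2) -
        (Λ + 2 * μ₀ / (x₀ ^ 2 + y₀ ^ 2)) * (x₀ * a + y₀ * b) ^ 2
  nondegenerate : ∀ a b,
    (μ₀ + 3 * K₀ * x₀ ^ 2 + K₁ * y₀ ^ 2) * a + 2 * K₁ * x₀ * y₀ * b = 0 →
    (μ₀ + 3 * K₀ * y₀ ^ 2 + K₁ * x₀ ^ 2) * b + 2 * K₁ * y₀ * x₀ * a = 0 → a = 0 ∧ b = 0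

/-- A critical point of the potential at which its angular part is extremal. -/
theorem isPass_of_radial {μ₀ K₀ K₁ Λ x₀ y₀ : ℝ} (hμ₀ : 0 < μ₀) (hΛ : 0 < Λ)
    (hr : 0 < x₀ ^ 2 + y₀ ^ 2)
    (hf1 : μ₀ + K₀ * x₀ ^ 2 + K₁ * y₀ ^ 2 = 0 ∨ x₀ = 0)
    (hf2 : μ₀ + K₀ * y₀ ^ 2 + K₁ * x₀ ^ 2 = 0 ∨ y₀ = 0)
    (hcircle : ∀ x y, x ^ 2 + y ^ 2 = x₀ ^ 2 + y₀ ^ 2 →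
      force μ₀ K₀ K₁ x y ^ 2 + force μ₀ K₀ K₁ y x ^ 2 =
      2 * (x₀ ^ 2 + y₀ ^ 2) * Λ * (potential μ₀ K₀ K₁ x y - potential μ₀ K₀ K₁ x₀ y₀))
    -- Along each ray the radial derivative of the potential vanishes only at 0 and possibly at one
    -- radius; this says that this radius is never smaller than that of the pass.
    (hmax : ∀ x y : ℝ, -(K₀ * (x ^ 4 + y ^ 4) + 2 * K₁ * (x ^ 2 * y ^ 2)) *
      (x₀ ^ 2 + y₀ ^ 2) ≤ μ₀ * (x ^ 2 + y ^ 2) ^ 2)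
    (hess11 : (μ₀ + 3 * K₀ * x₀ ^ 2 + K₁ * y₀ ^ 2) * (x₀ ^ 2 + y₀ ^ 2) =
      -2 * μ₀ * x₀ ^ 2 + Λ * (x₀ ^ 2 + y₀ ^ 2) * y₀ ^ 2)
    (hess12 : 2 * K₁ * x₀ * y₀ * (x₀ ^ 2 + y₀ ^ 2) =
      -2 * μ₀ * x₀ * y₀ - Λ * (x₀ ^ 2 + y₀ ^ 2) * (x₀ * y₀))
    (hess22 : (μ₀ + 3 * K₀ * y₀ ^ 2 + K₁ * x₀ ^ 2) * (x₀ ^ 2 + y₀ ^ 2) =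
      -2 * μ₀ * y₀ ^ 2 + Λ * (x₀ ^ 2 + y₀ ^ 2) * x₀ ^ 2) :
    IsPass μ₀ K₀ K₁ Λ x₀ y₀ := by
  have hforce1 : force μ₀ K₀ K₁ x₀ y₀ = 0 := by
    have : force μ₀ K₀ K₁ x₀ y₀ = (μ₀ + K₀ * x₀ ^ 2 + K₁ * y₀ ^ 2) * x₀ := by rw [force]; ring
    rw [this]
    rcases hf1 with h | h <;> rw [h] <;> simp
  have hforce2 : force μ₀ K₀ K₁ y₀ x₀ = 0 := by
    have : force μ₀ K₀ K₁ y₀ x₀ = (μ₀ + K₀ * y₀ ^ 2 + K₁ * x₀ ^ 2) * y₀ := by rw [force]; ring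
    rw [this]
    rcases hf2 with h | h <;> rw [h] <;> simp
  refine ⟨hΛ, hr, ?_, hforce1, hforce2, hcircle, ?_, ?_, ?_⟩
  -- Euler's identity for the quadratic and quartic parts: the height of a critical point is μ₀/4
  -- times its squared radius.
  · have h1 : potential μ₀ K₀ K₁ x₀ y₀ = μ₀ / 4 * (x₀ ^ 2 + y₀ ^ 2) +
        (x₀ * force μ₀ K₀ K₁ x₀ y₀ + y₀ * force μ₀ K₀ K₁ y₀ x₀) / 4 := by
      rw [potential, force, force]
      ring
    rw [h1, hforce1, hforce2]
    have : 0 < μ₀ / 4 * (x₀ ^ 2 + y₀ ^ 2) := by positivity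
    linarith
  · intro x y hxy h1 h2
    have h3 : x * force μ₀ K₀ K₁ x y + y * force μ₀ K₀ K₁ y x = μ₀ * (x ^ 2 + y ^ 2) +
        (K₀ * (x ^ 4 + y ^ 4) + 2 * K₁ * (x ^ 2 * y ^ 2)) := by
      rw [force, force]
      ring
    rw [h1, h2] at h3
    have h4 := hmax x y
    have h5 : x ^ 2 + y ^ 2 = 0 := by
      by_contra hne
      have hpos : 0 < x ^ 2 + y ^ 2 := lt_of_le_of_ne (by positivity) (Ne.symm hne)
      have h6 : μ₀ * (x ^ 2 + y ^ 2) * (x₀ ^ 2 + y₀ ^ 2) ≤ μ₀ * (x ^ 2 + y ^ 2) ^ 2 := by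
        have : μ₀ * (x ^ 2 + y ^ 2) =
          -(K₀ * (x ^ 4 + y ^ 4) + 2 * K₁ * (x ^ 2 * y ^ 2)) := by linarith
        rw [this]
        exact h4
      have h7 : 0 < μ₀ * (x ^ 2 + y ^ 2) * (x₀ ^ 2 + y₀ ^ 2 - (x ^ 2 + y ^ 2)) := by
        have := sub_pos.2 hxy
        positivity
      nlinarith
    constructor <;> nlinarith [sq_nonneg x, sq_nonneg y]
  · intro a b
    have hr' := hr.ne'
    field_simp
    linear_combination a ^ 2 * hess11 + 2 * a * b * hess12 + b ^ 2 * hess22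
  · intro a b h1 h2
    -- Pairing with the radial eigenvector (eigenvalue -2μ₀) here, and next with the tangential one
    -- (eigenvalue Λ times the squared radius), kills both components of (a, b).
    have h3 : 2 * μ₀ * (x₀ ^ 2 + y₀ ^ 2) * (x₀ * a + y₀ * b) = 0 := by
      linear_combination (-(x₀ ^ 2 + y₀ ^ 2)) * (x₀ * h1 + y₀ * h2) +
        x₀ * (a * hess11 + b * hess12) + y₀ * (b * hess22 + a * hess12)
    have h4 : Λ * (x₀ ^ 2 + y₀ ^ 2) ^ 2 * (x₀ * b - y₀ * a) = 0 := by
      linear_combination ((x₀ ^ 2 + y₀ ^ 2)) * (x₀ * h2 - y₀ * h1) -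
        x₀ * (b * hess22 + a * hess12) + y₀ * (a * hess11 + b * hess12)
    have h5 : x₀ * a + y₀ * b = 0 := by
      rcases mul_eq_zero.1 h3 with h | h
      · exact absurd h (by positivity)
      · exact h
    have h6 : x₀ * b - y₀ * a = 0 := by
      rcases mul_eq_zero.1 h4 with h | h
      · exact absurd h (by positivity)
      · exact h
    have h7 : (x₀ ^ 2 + y₀ ^ 2) * a = 0 := by linear_combination x₀ * h5 - y₀ * h6
    have h8 : (x₀ ^ 2 + y₀ ^ 2) * b = 0 := by linear_combination y₀ * h5 + x₀ * h6
    exact ⟨(mul_eq_zero.1 h7).resolve_left hr.ne', (mul_eq_zero.1 h8).resolve_left hr.ne'⟩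

/-- On the circle the excess potential is (K₀ - K₁)/8 · (x² - y²)², which is minimal exactly on the
diagonals when K₁ < K₀. -/
theorem isPass_of_mem_squares {μ₀ K₀ K₁ : ℝ} (hK₀ : K₀ < 0) (hK : K₁ < K₀) (hμ₀ : 0 < μ₀)
    {A : ℝ × ℝ} (hA : A ∈ squares μ₀ K₀ K₁) : IsPass μ₀ K₀ K₁ (K₀ - K₁) A.1 A.2 := by
  obtain ⟨x₀, y₀⟩ := A
  obtain ⟨h1, h2⟩ := hA
  simp only at h1 h2 ⊢
  have hs : 0 < -(μ₀ / (K₀ + K₁)) := by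
    rw [neg_pos]
    exact div_neg_of_pos_of_neg hμ₀ (by linarith)
  have hx : x₀ ^ 2 = -(μ₀ / (K₀ + K₁)) := by rw [← sq_abs, h1, Real.sq_sqrt hs.le]
  have hy : y₀ ^ 2 = x₀ ^ 2 := by rw [hx, ← sq_abs, h2, Real.sq_sqrt hs.le]
  have hK01 : K₀ + K₁ ≠ 0 := by linarith
  have hμ : μ₀ = -(K₀ + K₁) * x₀ ^ 2 := by
    rw [hx]
    field_simp
  have hx0 : 0 < x₀ ^ 2 := by rwa [hx]
  have hxy : (x₀ - y₀) * (x₀ + y₀) = 0 := by linear_combination -hy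
  clear hx h1 h2 hs
  refine isPass_of_radial hμ₀ (by linarith) (by positivity)
    (Or.inl (by rw [hy, hμ]; ring)) (Or.inl (by rw [hy, hμ]; ring)) ?_ ?_ ?_ ?_ ?_
  · intro x y hc
    rw [hy] at hc
    have hy4 : y₀ ^ 4 = x₀ ^ 4 := by linear_combination (y₀ ^ 2 + x₀ ^ 2) * hy
    rw [force, force, potential, potential, hy, hy4, hμ]
    have hx2 : x₀ ^ 2 = (x ^ 2 + y ^ 2) / 2 := by linarith
    have hx4 : x₀ ^ 4 = (x ^ 2 + y ^ 2) ^ 2 / 4 := by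
      rw [show x₀ ^ 4 = (x₀ ^ 2) ^ 2 by ring, hx2]
      ring
    rw [hx4, hx2]
    ring
  · intro x y
    rw [hy, hμ]
    have : 0 ≤ x₀ ^ 2 * (K₀ - K₁) * (x ^ 2 - y ^ 2) ^ 2 := by
      have : 0 < K₀ - K₁ := by linarith
      positivity
    nlinarith
  · rw [hy, hμ]; ring
  · rcases mul_eq_zero.1 hxy with h | h
    · rw [show y₀ = x₀ by linarith, hμ]; ring
    · rw [show y₀ = -x₀ by linarith, hμ]; ring
  · rw [hy, hμ]; ring

/-- On the circle the excess potential is (K₁ - K₀)/2 · x²y², which is minimal exactly on the axes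
when K₀ < K₁. -/
theorem isPass_of_mem_rolls {μ₀ K₀ K₁ : ℝ} (hK₀ : K₀ < 0) (hK : K₀ < K₁) (hμ₀ : 0 < μ₀)
    {A : ℝ × ℝ} (hA : A ∈ rolls μ₀ K₀) : IsPass μ₀ K₀ K₁ (K₁ - K₀) A.1 A.2 := by
  obtain ⟨x₀, y₀⟩ := A
  obtain ⟨h1, h2⟩ := hA
  simp only at h1 h2 ⊢
  subst h2
  have hs : 0 < -(μ₀ / K₀) := by
    rw [neg_pos]
    exact div_neg_of_pos_of_neg hμ₀ hK₀
  have hx : x₀ ^ 2 = -(μ₀ / K₀) := by rw [← sq_abs, h1, Real.sq_sqrt hs.le]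
  have hμ : μ₀ = -K₀ * x₀ ^ 2 := by
    have := hK₀.ne
    rw [hx]
    field_simp
  have hx0 : 0 < x₀ ^ 2 := by rwa [hx]
  clear hx h1 hs
  refine isPass_of_radial hμ₀ (by linarith) (by positivity)
    (Or.inl (by rw [hμ]; ring)) (Or.inr rfl) ?_ ?_ ?_ ?_ ?_
  · intro x y hc
    rw [force, force, potential, potential, hμ]
    have hx2 : x₀ ^ 2 = x ^ 2 + y ^ 2 := by linarith
    have hx4 : x₀ ^ 4 = (x ^ 2 + y ^ 2) ^ 2 := by rw [show x₀ ^ 4 = (x₀ ^ 2) ^ 2 by ring, hx2]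
    rw [hx4, hx2]
    ring
  · intro x y
    rw [hμ]
    have : 0 ≤ x₀ ^ 2 * (K₁ - K₀) * (x ^ 2 * y ^ 2) := by
      have : 0 < K₁ - K₀ := by linarith
      positivity
    nlinarith
  · rw [hμ]; ring
  · ring
  · rw [hμ]; ring

/-! ### Damped gradient systems and derivatives of the corrected energy. -/

section DampedGradient

variable {E : Type*} [NormedAddCommGroup E] [NormedSpace ℝ E]

/-- `F` is the vector field of a damped gradient system for the amplitudes `a₁`, `a₂` with
velocities `b₁`, `b₂`; if `b₂` vanishes identically, the second amplitude is overdamped. -/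
structure IsDampedGradient (c₀ μ₀ K₀ K₁ m₁ m₂ : ℝ) (F : E → E) (a₁ b₁ a₂ b₂ : E →L[ℝ] ℝ) :
    Prop where
  contDiff : ContDiff ℝ 1 F
  norm_sq_le : ∀ x, ‖x‖ ^ 2 ≤ a₁ x ^ 2 + b₁ x ^ 2 + a₂ x ^ 2 + b₂ x ^ 2
  fst_position : ∀ x, a₁ (F x) = b₁ x
  fst_velocity : ∀ x, m₁ * b₁ (F x) = -(force μ₀ K₀ K₁ (a₁ x) (a₂ x) + c₀ * b₁ x)
  snd_position : (∀ x, b₂ x = a₂ (F x)) ∨ ∀ x, b₂ x = 0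
  snd_velocity : ∀ x, m₂ * b₂ (F x) = -(force μ₀ K₀ K₁ (a₂ x) (a₁ x) + c₀ * a₂ (F x))

/-- The total energy, corrected by a multiple `γ` of the momentum in the direction of the force. -/
noncomputable def lyapunov (μ₀ K₀ K₁ m₁ m₂ γ : ℝ) (a₁ b₁ a₂ b₂ : E →L[ℝ] ℝ) (x : E) : ℝ :=
  m₁ / 2 * b₁ x ^ 2 + m₂ / 2 * b₂ x ^ 2 + potential μ₀ K₀ K₁ (a₁ x) (a₂ x) +
    γ * (m₁ * (b₁ x * force μ₀ K₀ K₁ (a₁ x) (a₂ x)) +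
      m₂ * (b₂ x * force μ₀ K₀ K₁ (a₂ x) (a₁ x)))

theorem hasDerivAt_line (ℓ : E →L[ℝ] ℝ) (x v : E) (t : ℝ) :
    HasDerivAt (fun s : ℝ ↦ ℓ (x + s • v)) (ℓ v) t := by
  have h : HasDerivAt (fun s : ℝ ↦ x + s • v) v t := by
    simpa using ((hasDerivAt_id t).smul_const v).const_add x
  exact ℓ.hasFDerivAt.comp_hasDerivAt t h

theorem fderiv_apply_of_line {F : Type*} [NormedAddCommGroup F] [NormedSpace ℝ F] {f : E → F}
    {x v : E} {d : F} (hf : DifferentiableAt ℝ f x)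
    (h : HasDerivAt (fun s : ℝ ↦ f (x + s • v)) d 0) : fderiv ℝ f x v = d := by
  have hl : HasDerivAt (fun s : ℝ ↦ x + s • v) v 0 := by
    simpa using ((hasDerivAt_id (0 : ℝ)).smul_const v).const_add x
  have hf' : HasFDerivAt f (fderiv ℝ f x) (x + (0 : ℝ) • v) := by
    simpa using hf.hasFDerivAt
  exact (hf'.comp_hasDerivAt 0 hl).unique h

theorem hasDerivAt_fderiv_line {D : E → E →L[ℝ] ℝ} {p : E} (hD : DifferentiableAt ℝ D p)
    (w : E) : HasDerivAt (fun s : ℝ ↦ D (p + s • w) w) (fderiv ℝ D p w w) 0 := by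
  have hl : HasDerivAt (fun s : ℝ ↦ p + s • w) w 0 := by
    simpa using ((hasDerivAt_id (0 : ℝ)).smul_const w).const_add p
  have hd : HasFDerivAt D (fderiv ℝ D p) (p + (0 : ℝ) • w) := by
    simpa using hD.hasFDerivAt
  exact (ContinuousLinearMap.apply ℝ ℝ w).hasFDerivAt.comp_hasDerivAt 0
    (hd.comp_hasDerivAt 0 hl)

variable {c₀ μ₀ K₀ K₁ m₁ m₂ γ : ℝ} {a₁ b₁ a₂ b₂ : E →L[ℝ] ℝ}

theorem contDiff_lyapunov : ContDiff ℝ 2 (lyapunov μ₀ K₀ K₁ m₁ m₂ γ a₁ b₁ a₂ b₂) := by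
  unfold lyapunov potential force
  fun_prop

theorem fderiv_lyapunov (x v : E) :
    fderiv ℝ (lyapunov μ₀ K₀ K₁ m₁ m₂ γ a₁ b₁ a₂ b₂) x v =
      m₁ * b₁ x * b₁ v + m₂ * b₂ x * b₂ v +
      (force μ₀ K₀ K₁ (a₁ x) (a₂ x) * a₁ v + force μ₀ K₀ K₁ (a₂ x) (a₁ x) * a₂ v) +
      γ * (m₁ * (b₁ v * force μ₀ K₀ K₁ (a₁ x) (a₂ x) +
          b₁ x * ((μ₀ + 3 * K₀ * a₁ x ^ 2 + K₁ * a₂ x ^ 2) * a₁ v +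
            2 * K₁ * a₁ x * a₂ x * a₂ v)) +
        m₂ * (b₂ v * force μ₀ K₀ K₁ (a₂ x) (a₁ x) +
          b₂ x * ((μ₀ + 3 * K₀ * a₂ x ^ 2 + K₁ * a₁ x ^ 2) * a₂ v +
            2 * K₁ * a₂ x * a₁ x * a₁ v))) := by
  refine fderiv_apply_of_line (contDiff_lyapunov.differentiable (by simp) x) ?_
  have ha1 := hasDerivAt_line a₁ x v 0
  have hb1 := hasDerivAt_line b₁ x v 0
  have ha2 := hasDerivAt_line a₂ x v 0
  have hb2 := hasDerivAt_line b₂ x v 0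
  have h := ((((hb1.pow 2).const_mul (m₁ / 2)).add ((hb2.pow 2).const_mul (m₂ / 2))).add
    (hasDerivAt_potential μ₀ K₀ K₁ ha1 ha2)).add
    ((((hb1.mul (hasDerivAt_force μ₀ K₀ K₁ ha1 ha2)).const_mul m₁).add
      ((hb2.mul (hasDerivAt_force μ₀ K₀ K₁ ha2 ha1)).const_mul m₂)).const_mul γ)
  convert! h using 1
  simp only [zero_smul, add_zero]
  ring

/-- The velocities vanish at `p`, so third derivatives of the potential drop out of the cross term.
-/
theorem fderiv_fderiv_lyapunov {p : E} (hb1 : b₁ p = 0) (hb2 : b₂ p = 0) (w : E) :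
    fderiv ℝ (fderiv ℝ (lyapunov μ₀ K₀ K₁ m₁ m₂ γ a₁ b₁ a₂ b₂)) p w w =
      m₁ * b₁ w ^ 2 + m₂ * b₂ w ^ 2 +
      (((μ₀ + 3 * K₀ * a₁ p ^ 2 + K₁ * a₂ p ^ 2) * a₁ w + 2 * K₁ * a₁ p * a₂ p * a₂ w) * a₁ w +
        ((μ₀ + 3 * K₀ * a₂ p ^ 2 + K₁ * a₁ p ^ 2) * a₂ w + 2 * K₁ * a₂ p * a₁ p * a₁ w) * a₂ w) +
      2 * γ * (m₁ * (b₁ w * ((μ₀ + 3 * K₀ * a₁ p ^ 2 + K₁ * a₂ p ^ 2) * a₁ w +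
            2 * K₁ * a₁ p * a₂ p * a₂ w)) +
        m₂ * (b₂ w * ((μ₀ + 3 * K₀ * a₂ p ^ 2 + K₁ * a₁ p ^ 2) * a₂ w +
            2 * K₁ * a₂ p * a₁ p * a₁ w))) := by
  have hdiff : DifferentiableAt ℝ (fderiv ℝ (lyapunov μ₀ K₀ K₁ m₁ m₂ γ a₁ b₁ a₂ b₂)) p :=
    ((contDiff_lyapunov.fderiv_right (m := 1) (by norm_num)).differentiable (by simp)) p
  have happ := hasDerivAt_fderiv_line hdiff w
  refine happ.unique ?_
  simp only [fderiv_lyapunov]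
  have ha1 := hasDerivAt_line a₁ p w 0
  have hb1' := hasDerivAt_line b₁ p w 0
  have ha2 := hasDerivAt_line a₂ p w 0
  have hb2' := hasDerivAt_line b₂ p w 0
  have hg1 := hasDerivAt_force μ₀ K₀ K₁ ha1 ha2
  have hg2 := hasDerivAt_force μ₀ K₀ K₁ ha2 ha1
  have hk1 := hb1'.mul ((((((ha1.pow 2).const_mul (3 * K₀)).const_add μ₀).add
    ((ha2.pow 2).const_mul K₁)).mul_const (a₁ w)).add
      (((ha1.const_mul (2 * K₁)).mul ha2).mul_const (a₂ w)))
  have hk2 := hb2'.mul ((((((ha2.pow 2).const_mul (3 * K₀)).const_add μ₀).add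
    ((ha1.pow 2).const_mul K₁)).mul_const (a₂ w)).add
      (((ha2.const_mul (2 * K₁)).mul ha1).mul_const (a₁ w)))
  have h := ((((hb1'.const_mul m₁).mul_const (b₁ w)).add
    ((hb2'.const_mul m₂).mul_const (b₂ w))).add ((hg1.mul_const (a₁ w)).add
      (hg2.mul_const (a₂ w)))).add
    (((((hg1.const_mul (b₁ w)).add hk1).const_mul m₁).add
      (((hg2.const_mul (b₂ w)).add hk2).const_mul m₂)).const_mul γ)
  convert! h using 1
  simp only [zero_smul, add_zero, hb1, hb2, Pi.add_apply, Pi.mul_apply, Pi.pow_apply]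
  ring

namespace IsDampedGradient

variable {F : E → E}

theorem map_eq_zero (H : IsDampedGradient c₀ μ₀ K₀ K₁ m₁ m₂ F a₁ b₁ a₂ b₂) (hc₀ : 0 < c₀)
    (hm₁ : 0 < m₁) (hm₂ : 0 < m₂) {p : E} (hb1 : b₁ p = 0) (hb2 : b₂ p = 0)
    (hf1 : force μ₀ K₀ K₁ (a₁ p) (a₂ p) = 0) (hf2 : force μ₀ K₀ K₁ (a₂ p) (a₁ p) = 0) :
    F p = 0 := by
  have h1 : a₁ (F p) = 0 := by rw [H.fst_position, hb1]
  have h2 : b₁ (F p) = 0 := by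
    have := H.fst_velocity p
    rw [hf1, hb1] at this
    simpa [hm₁.ne'] using this
  have h3 : a₂ (F p) = 0 := by
    rcases H.snd_position with h | h
    · rw [← h, hb2]
    · have := H.snd_velocity p
      rw [h, hf2] at this
      simpa [hc₀.ne'] using this.symm
  have h4 : b₂ (F p) = 0 := by
    have := H.snd_velocity p
    rw [hf2, h3] at this
    simpa [hm₂.ne'] using this
  have h5 := H.norm_sq_le (F p)
  rw [h1, h2, h3, h4] at h5
  refine norm_le_zero_iff.1 ?_
  nlinarith [norm_nonneg (F p)]

theorem eq_zero_of_map_eq_zero (H : IsDampedGradient c₀ μ₀ K₀ K₁ m₁ m₂ F a₁ b₁ a₂ b₂) {x : E}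
    (hx : F x = 0) : b₁ x = 0 ∧ b₂ x = 0 ∧ force μ₀ K₀ K₁ (a₁ x) (a₂ x) = 0 ∧
      force μ₀ K₀ K₁ (a₂ x) (a₁ x) = 0 := by
  have h1 : b₁ x = 0 := by rw [← H.fst_position, hx, map_zero]
  have h2 : b₂ x = 0 := by
    rcases H.snd_position with h | h
    · rw [h, hx, map_zero]
    · exact h x
  refine ⟨h1, h2, ?_, ?_⟩
  · have := H.fst_velocity x
    simpa [hx, h1] using this.symm
  · have := H.snd_velocity x
    simpa [hx] using this.symm

/-- Differentiating the defining relations along a kernel vector removes its velocities together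
with all inertial and damping terms; what remains is the Hessian of the potential applied to its
amplitudes. -/
theorem injective_fderiv (H : IsDampedGradient c₀ μ₀ K₀ K₁ m₁ m₂ F a₁ b₁ a₂ b₂) {p : E}
    (hnd : ∀ a b, (μ₀ + 3 * K₀ * a₁ p ^ 2 + K₁ * a₂ p ^ 2) * a + 2 * K₁ * a₁ p * a₂ p * b = 0 →
      (μ₀ + 3 * K₀ * a₂ p ^ 2 + K₁ * a₁ p ^ 2) * b + 2 * K₁ * a₂ p * a₁ p * a = 0 →
      a = 0 ∧ b = 0) :
    Function.Injective (fderiv ℝ F p) := by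
  refine (injective_iff_map_eq_zero _).2 fun w hw ↦ ?_
  have hd : ∀ ℓ : E →L[ℝ] ℝ, HasDerivAt (fun s : ℝ ↦ ℓ (F (p + s • w))) 0 0 := by
    intro ℓ
    have hl : HasDerivAt (fun s : ℝ ↦ p + s • w) w 0 := by
      simpa using ((hasDerivAt_id (0 : ℝ)).smul_const w).const_add p
    have hF : HasFDerivAt F (fderiv ℝ F p) (p + (0 : ℝ) • w) := by
      simpa using (H.contDiff.differentiable (by simp) p).hasFDerivAt
    have := ℓ.hasFDerivAt.comp_hasDerivAt 0 (hF.comp_hasDerivAt 0 hl)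
    simpa [hw, Function.comp_def] using! this
  have ha1 := hasDerivAt_line a₁ p w 0
  have ha2 := hasDerivAt_line a₂ p w 0
  have h1 : b₁ w = 0 := by
    have := hd a₁
    simp only [H.fst_position] at this
    exact (hasDerivAt_line b₁ p w 0).unique this
  have h2 : b₂ w = 0 := by
    rcases H.snd_position with h | h
    · have := hd a₂
      simp only [← h] at this
      exact (hasDerivAt_line b₂ p w 0).unique this
    · exact h w
  have h3 := ((hasDerivAt_force μ₀ K₀ K₁ ha1 ha2).add
    ((hasDerivAt_line b₁ p w 0).const_mul c₀)).neg.unique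
    (((hd b₁).const_mul m₁).congr_of_eventuallyEq
      (Eventually.of_forall fun s ↦ (H.fst_velocity _).symm))
  have h4 := ((hasDerivAt_force μ₀ K₀ K₁ ha2 ha1).add
    ((hd a₂).const_mul c₀)).neg.unique
    (((hd b₂).const_mul m₂).congr_of_eventuallyEq
      (Eventually.of_forall fun s ↦ (H.snd_velocity _).symm))
  simp only [zero_smul, add_zero, mul_zero, h1, neg_eq_zero] at h3 h4
  obtain ⟨h5, h6⟩ := hnd _ _ h3 h4
  have h7 := H.norm_sq_le w
  rw [h1, h2, h5, h6] at h7
  refine norm_le_zero_iff.1 ?_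
  nlinarith [norm_nonneg w]

end IsDampedGradient

end DampedGradient

/-! ### Bounds on discs and the pointwise dissipation inequality. -/

theorem exists_bound_on_disc {f : ℝ → ℝ → ℝ} (hf : Continuous fun q : ℝ × ℝ ↦ f q.1 q.2)
    (Q : ℝ) : ∃ N, ∀ x y, x ^ 2 + y ^ 2 ≤ Q → |f x y| ≤ N := by
  obtain ⟨N, hN⟩ := (isCompact_closedBall (0 : ℝ × ℝ) (|Q| + 1)).exists_bound_of_continuousOn
    hf.continuousOn
  refine ⟨N, fun x y hxy ↦ hN (x, y) ?_⟩
  have hQ := le_abs_self Q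
  have hQ0 := abs_nonneg Q
  rw [mem_closedBall_zero_iff, Prod.norm_def]
  exact max_le (abs_le_of_sq_le_sq (by nlinarith [sq_nonneg y]) (by positivity))
    (abs_le_of_sq_le_sq (by nlinarith [sq_nonneg x]) (by positivity))

theorem exists_bounds (μ₀ K₀ K₁ Q : ℝ) : ∃ N > 0, ∀ x y, x ^ 2 + y ^ 2 ≤ Q →
    |potential μ₀ K₀ K₁ x y| ≤ N ∧ |force μ₀ K₀ K₁ x y| ≤ N ∧
      |μ₀ + 3 * K₀ * x ^ 2 + K₁ * y ^ 2| ≤ N ∧ |2 * K₁ * x * y| ≤ N := by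
  obtain ⟨N₁, h₁⟩ := exists_bound_on_disc (f := potential μ₀ K₀ K₁)
    (by unfold potential; fun_prop) Q
  obtain ⟨N₂, h₂⟩ := exists_bound_on_disc (f := force μ₀ K₀ K₁) (by unfold force; fun_prop) Q
  obtain ⟨N₃, h₃⟩ := exists_bound_on_disc
    (f := fun x y ↦ μ₀ + 3 * K₀ * x ^ 2 + K₁ * y ^ 2) (by fun_prop) Q
  obtain ⟨N₄, h₄⟩ := exists_bound_on_disc (f := fun x y ↦ 2 * K₁ * x * y) (by fun_prop) Q
  refine ⟨|N₁| + |N₂| + |N₃| + |N₄| + 1, by positivity, fun x y hxy ↦ ?_⟩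
  have := abs_nonneg N₁
  have := abs_nonneg N₂
  have := abs_nonneg N₃
  have := abs_nonneg N₄
  exact ⟨by linarith [h₁ x y hxy, le_abs_self N₁], by linarith [h₂ x y hxy, le_abs_self N₂],
    by linarith [h₃ x y hxy, le_abs_self N₃], by linarith [h₄ x y hxy, le_abs_self N₄]⟩

theorem mul_linear_le {N h k b y : ℝ} (hh : |h| ≤ N) (hk : |k| ≤ N) :
    b * (h * b + k * y) ≤ N * (3 / 2 * b ^ 2 + 1 / 2 * y ^ 2) := by
  have h1 : h * b ^ 2 ≤ N * b ^ 2 := by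
    have := (abs_le.1 hh).2
    gcongr
  have h2 : k * (b * y) ≤ N * ((b ^ 2 + y ^ 2) / 2) := by
    calc k * (b * y) ≤ |k * (b * y)| := le_abs_self _
      _ = |k| * |b * y| := abs_mul _ _
      _ ≤ N * ((b ^ 2 + y ^ 2) / 2) := by
          have : |b * y| ≤ (b ^ 2 + y ^ 2) / 2 := by
            rw [abs_le]
            constructor <;> nlinarith [sq_nonneg (b + y), sq_nonneg (b - y)]
          have := (abs_nonneg k).trans hk
          gcongr
  linarith

/-- The dissipation of the corrected energy. -/
theorem dissipation_estimate {c₀ m₁ m₂ m γ N f₁ f₂ b₁ b₂ y b₁' b₂' h₁₁ h₁₂ h₂₂ h₂₁ : ℝ}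
    (hm₁ : 0 ≤ m₁) (hm₂ : 0 ≤ m₂) (hm₁' : m₁ ≤ m) (hm₂' : m₂ ≤ m) (hγ : 0 < γ) (hN : 0 < N)
    (hγc : (2 * m * N + c₀ ^ 2 / 2) * γ ≤ c₀ / 2)
    (h1 : m₁ * b₁' = -(f₁ + c₀ * b₁)) (h2 : m₂ * b₂' = -(f₂ + c₀ * y))
    (hb : b₂ = y ∨ (b₂ = 0 ∧ b₂' = 0))
    (H₁₁ : |h₁₁| ≤ N) (H₁₂ : |h₁₂| ≤ N) (H₂₂ : |h₂₂| ≤ N) (H₂₁ : |h₂₁| ≤ N) :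
    m₁ * b₁ * b₁' + m₂ * b₂ * b₂' + (f₁ * b₁ + f₂ * y) +
      γ * (m₁ * (b₁' * f₁ + b₁ * (h₁₁ * b₁ + h₁₂ * y)) +
        m₂ * (b₂' * f₂ + b₂ * (h₂₂ * y + h₂₁ * b₁))) ≤
      -(c₀ / 2 * (b₁ ^ 2 + y ^ 2) + γ / 2 * (f₁ ^ 2 + f₂ ^ 2)) := by
  have e1 := mul_linear_le (b := b₁) (y := y) H₁₁ H₁₂
  have e2 := mul_linear_le (b := y) (y := b₁) H₂₂ H₂₁
  have k1 : m₁ * (b₁ * (h₁₁ * b₁ + h₁₂ * y)) ≤ m * (N * (3 / 2 * b₁ ^ 2 + 1 / 2 * y ^ 2)) :=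
    (mul_le_mul_of_nonneg_left e1 hm₁).trans (by gcongr)
  have k2 : m₂ * (b₂ * (h₂₂ * y + h₂₁ * b₁)) ≤ m * (N * (3 / 2 * y ^ 2 + 1 / 2 * b₁ ^ 2)) := by
    rcases hb with rfl | ⟨rfl, -⟩
    · exact (mul_le_mul_of_nonneg_left e2 hm₂).trans (by gcongr)
    · have : 0 ≤ m := hm₁.trans hm₁'
      rw [zero_mul, mul_zero]
      positivity
  -- Here `y` is the rate of the second amplitude. With or without inertia, the energy balance of
  -- that mode is the same.
  have k3 : m₂ * b₂ * b₂' + f₂ * y = -(c₀ * y ^ 2) := by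
    rcases hb with rfl | ⟨rfl, rfl⟩
    · linear_combination b₂ * h2
    · linear_combination y * h2
  have k4 : m₁ * b₁ * b₁' + f₁ * b₁ = -(c₀ * b₁ ^ 2) := by linear_combination b₁ * h1
  have k5 : m₁ * (b₁' * f₁) = -f₁ ^ 2 - c₀ * b₁ * f₁ := by linear_combination f₁ * h1
  have k6 : m₂ * (b₂' * f₂) = -f₂ ^ 2 - c₀ * y * f₂ := by linear_combination f₂ * h2
  have k7 : -f₁ ^ 2 - c₀ * b₁ * f₁ ≤ -f₁ ^ 2 / 2 + c₀ ^ 2 / 2 * b₁ ^ 2 := by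
    nlinarith [sq_nonneg (f₁ + c₀ * b₁)]
  have k8 : -f₂ ^ 2 - c₀ * y * f₂ ≤ -f₂ ^ 2 / 2 + c₀ ^ 2 / 2 * y ^ 2 := by
    nlinarith [sq_nonneg (f₂ + c₀ * y)]
  -- The cross term produces the decay of the forces at the price of velocity terms of order γ,
  -- which half of the damping absorbs by `hγc`.
  have k9 : γ * (m₁ * (b₁' * f₁ + b₁ * (h₁₁ * b₁ + h₁₂ * y)) +
      m₂ * (b₂' * f₂ + b₂ * (h₂₂ * y + h₂₁ * b₁))) ≤
      γ * ((2 * m * N + c₀ ^ 2 / 2) * (b₁ ^ 2 + y ^ 2) - (f₁ ^ 2 + f₂ ^ 2) / 2) := by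
    refine mul_le_mul_of_nonneg_left ?_ hγ.le
    linarith
  have k10 : (2 * m * N + c₀ ^ 2 / 2) * γ * (b₁ ^ 2 + y ^ 2) ≤ c₀ / 2 * (b₁ ^ 2 + y ^ 2) := by
    gcongr
  linarith

theorem velocity_sq_le {c₀ m k f b b' : ℝ} (hk : 0 < k) (hm : k ≤ m)
    (h : m * b' = -(f + c₀ * b)) : b' ^ 2 ≤ (2 * f ^ 2 + 2 * c₀ ^ 2 * b ^ 2) / k ^ 2 := by
  rw [le_div_iff₀ (by positivity)]
  have h1 : k ^ 2 ≤ m ^ 2 := by gcongr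
  have h2 : (m * b') ^ 2 = (f + c₀ * b) ^ 2 := by rw [h]; ring
  nlinarith [sq_nonneg (f - c₀ * b), mul_le_mul_of_nonneg_left h1 (sq_nonneg b')]

/-! ### The corrected energy as a mountain-pass Lyapunov function. -/

section DampedGradient

variable {E : Type*} [NormedAddCommGroup E] [NormedSpace ℝ E]
  {c₀ μ₀ K₀ K₁ m₁ m₂ γ Λ : ℝ} {a₁ b₁ a₂ b₂ : E →L[ℝ] ℝ} {F : E → E} {p : E}

theorem IsDampedGradient.dissipation (H : IsDampedGradient c₀ μ₀ K₀ K₁ m₁ m₂ F a₁ b₁ a₂ b₂)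
    (hc₀ : 0 < c₀) (hm₁ : 0 < m₁) (hm₂ : 0 < m₂) (hγ : 0 < γ) {m N Q : ℝ} (hm₁' : m₁ ≤ m)
    (hm₂' : m₂ ≤ m) (hN : 0 < N)
    (hbd : ∀ x y, x ^ 2 + y ^ 2 ≤ Q → |μ₀ + 3 * K₀ * x ^ 2 + K₁ * y ^ 2| ≤ N ∧
      |2 * K₁ * x * y| ≤ N)
    (hγc : (2 * m * N + c₀ ^ 2 / 2) * γ ≤ c₀ / 2) :
    ∃ c > 0, ∀ x, a₁ x ^ 2 + a₂ x ^ 2 ≤ Q →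
      fderiv ℝ (lyapunov μ₀ K₀ K₁ m₁ m₂ γ a₁ b₁ a₂ b₂) x (F x) ≤ -(c * ‖F x‖ ^ 2) := by
  set k := min m₁ m₂ with hk
  have hk0 : 0 < k := lt_min hm₁ hm₂
  -- Every component of the field is a rate of an amplitude or a combination of force and damping
  -- divided by a mass, so ‖F x‖² is at most `D` times the squared rates and forces that are
  -- dissipated.
  set D := 1 + (2 + 2 * c₀ ^ 2) / k ^ 2 with hD
  have hD0 : 0 < D := by positivity
  set d := min (c₀ / 2) (γ / 2) with hd
  have hd0 : 0 < d := by positivity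
  refine ⟨d / D, by positivity, fun x hx ↦ ?_⟩
  obtain ⟨n1, n2⟩ := hbd _ _ hx
  obtain ⟨n3, n4⟩ := hbd (a₂ x) (a₁ x) (by linarith)
  have h1 := H.fst_velocity x
  have h2 := H.snd_velocity x
  have hb : b₂ x = a₂ (F x) ∨ (b₂ x = 0 ∧ b₂ (F x) = 0) :=
    H.snd_position.imp (fun h ↦ h x) fun h ↦ ⟨h x, h (F x)⟩
  have hest := dissipation_estimate hm₁.le hm₂.le hm₁' hm₂' hγ hN hγc h1 h2 hb n1 n2 n3 n4
  rw [fderiv_lyapunov, H.fst_position]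
  refine hest.trans (neg_le_neg ?_)
  have v1 := velocity_sq_le hk0 (min_le_left _ _) h1
  have v2 := velocity_sq_le hk0 (min_le_right _ _) h2
  have hn := H.norm_sq_le (F x)
  rw [H.fst_position] at hn
  generalize force μ₀ K₀ K₁ (a₁ x) (a₂ x) = f₁ at *
  generalize force μ₀ K₀ K₁ (a₂ x) (a₁ x) = f₂ at *
  generalize b₁ x = s at *
  generalize a₂ (F x) = y at *
  have hF : ‖F x‖ ^ 2 ≤ D * ((s ^ 2 + y ^ 2) + (f₁ ^ 2 + f₂ ^ 2)) := by
    have e : D * ((s ^ 2 + y ^ 2) + (f₁ ^ 2 + f₂ ^ 2)) =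
        (s ^ 2 + y ^ 2) + (f₁ ^ 2 + f₂ ^ 2) + (2 * f₁ ^ 2 + 2 * c₀ ^ 2 * s ^ 2) / k ^ 2 +
        (2 * f₂ ^ 2 + 2 * c₀ ^ 2 * y ^ 2) / k ^ 2 +
        (2 * (s ^ 2 + y ^ 2) + 2 * c₀ ^ 2 * (f₁ ^ 2 + f₂ ^ 2)) / k ^ 2 := by
      rw [hD]
      ring
    have e2 : 0 ≤ (2 * (s ^ 2 + y ^ 2) + 2 * c₀ ^ 2 * (f₁ ^ 2 + f₂ ^ 2)) / k ^ 2 := by positivity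
    have e3 : 0 ≤ f₁ ^ 2 + f₂ ^ 2 := by positivity
    linarith
  calc d / D * ‖F x‖ ^ 2 ≤ d / D * (D * ((s ^ 2 + y ^ 2) + (f₁ ^ 2 + f₂ ^ 2))) := by gcongr
    _ = d * (s ^ 2 + y ^ 2) + d * (f₁ ^ 2 + f₂ ^ 2) := by field_simp
    _ ≤ c₀ / 2 * (s ^ 2 + y ^ 2) + γ / 2 * (f₁ ^ 2 + f₂ ^ 2) := by
        gcongr
        · exact min_le_left _ _
        · exact min_le_right _ _

theorem lyapunov_of_equilibrium (hb1 : b₁ p = 0) (hb2 : b₂ p = 0) :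
    lyapunov μ₀ K₀ K₁ m₁ m₂ γ a₁ b₁ a₂ b₂ p = potential μ₀ K₀ K₁ (a₁ p) (a₂ p) := by
  simp [lyapunov, hb1, hb2]

/-- Completing squares in the velocities bounds the loss from the cross term by mγ²|∇V|²/2. On the
circle |∇V|² is proportional to the excess height, which therefore covers the loss for small γ. -/
theorem lyapunov_le_on_circle (hm₁ : 0 < m₁) (hm₂ : 0 < m₂)
    (hp : IsPass μ₀ K₀ K₁ Λ (a₁ p) (a₂ p)) (hb1 : b₁ p = 0) (hb2 : b₂ p = 0) {m : ℝ}
    (hm₁' : m₁ ≤ m) (hm₂' : m₂ ≤ m)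
    (hγm : m * ((a₁ p ^ 2 + a₂ p ^ 2) * Λ) * γ ^ 2 ≤ 1) {x : E}
    (hx : a₁ x ^ 2 + a₂ x ^ 2 = a₁ p ^ 2 + a₂ p ^ 2) :
    lyapunov μ₀ K₀ K₁ m₁ m₂ γ a₁ b₁ a₂ b₂ p ≤ lyapunov μ₀ K₀ K₁ m₁ m₂ γ a₁ b₁ a₂ b₂ x := by
  rw [lyapunov_of_equilibrium hb1 hb2, lyapunov]
  have hc := hp.circle _ _ hx
  have hPΛ : 0 < (a₁ p ^ 2 + a₂ p ^ 2) * Λ := mul_pos hp.radius_pos hp.gap_pos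
  generalize potential μ₀ K₀ K₁ (a₁ x) (a₂ x) = V at *
  generalize potential μ₀ K₀ K₁ (a₁ p) (a₂ p) = V₀ at *
  generalize force μ₀ K₀ K₁ (a₁ x) (a₂ x) = f₁ at *
  generalize force μ₀ K₀ K₁ (a₂ x) (a₁ x) = f₂ at *
  set q := (a₁ p ^ 2 + a₂ p ^ 2) * Λ with hq
  have h0 : f₁ ^ 2 + f₂ ^ 2 = 2 * q * (V - V₀) := by rw [hc, hq]; ring
  have h1 : -(m₁ * (γ ^ 2 * f₁ ^ 2) / 2) ≤ m₁ / 2 * b₁ x ^ 2 + γ * (m₁ * (b₁ x * f₁)) := by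
    have : 0 ≤ m₁ / 2 * (b₁ x + γ * f₁) ^ 2 := by positivity
    nlinarith
  have h2 : -(m₂ * (γ ^ 2 * f₂ ^ 2) / 2) ≤ m₂ / 2 * b₂ x ^ 2 + γ * (m₂ * (b₂ x * f₂)) := by
    have : 0 ≤ m₂ / 2 * (b₂ x + γ * f₂) ^ 2 := by positivity
    nlinarith
  have h3 : m₁ * (γ ^ 2 * f₁ ^ 2) ≤ m * (γ ^ 2 * f₁ ^ 2) := by gcongr
  have h4 : m₂ * (γ ^ 2 * f₂ ^ 2) ≤ m * (γ ^ 2 * f₂ ^ 2) := by gcongr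
  have hV : 0 ≤ V - V₀ := by
    by_contra! hneg
    nlinarith [sq_nonneg f₁, sq_nonneg f₂]
  have h5 : m * γ ^ 2 * (f₁ ^ 2 + f₂ ^ 2) ≤ 2 * (V - V₀) := by
    calc m * γ ^ 2 * (f₁ ^ 2 + f₂ ^ 2) = m * q * γ ^ 2 * (2 * (V - V₀)) := by rw [h0]; ring
      _ ≤ 1 * (2 * (V - V₀)) := by gcongr
      _ = 2 * (V - V₀) := one_mul _
  linarith

/-- Half of the kinetic form is spent on completing squares, leaving a cross-term loss of order γ²
in the amplitudes. -/
theorem transverse_estimate {f g s t a b X Y N m : ℝ} (hm₁ : 0 < m₁) (hm₂ : 0 < m₂)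
    (hm₁' : m₁ ≤ m) (hm₂' : m₂ ≤ m) (hX : X = f * a + g * b) (hY : Y = s * b + t * a)
    (hf : |f| ≤ N) (hg : |g| ≤ N) (hs : |s| ≤ N) (ht : |t| ≤ N) (u v : ℝ) :
    m₁ / 2 * u ^ 2 + m₂ / 2 * v ^ 2 - 8 * m * N ^ 2 * γ ^ 2 * (a ^ 2 + b ^ 2) ≤
      m₁ * u ^ 2 + m₂ * v ^ 2 + 2 * γ * (m₁ * (u * X) + m₂ * (v * Y)) := by
  have hsq : ∀ f g a b : ℝ, |f| ≤ N → |g| ≤ N →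
      (f * a + g * b) ^ 2 ≤ 2 * N ^ 2 * (a ^ 2 + b ^ 2) := by
    intro f g a b hf hg
    have h1 : f ^ 2 ≤ N ^ 2 := sq_le_sq' (abs_le.1 hf).1 (abs_le.1 hf).2
    have h2 : g ^ 2 ≤ N ^ 2 := sq_le_sq' (abs_le.1 hg).1 (abs_le.1 hg).2
    nlinarith [sq_nonneg (f * a - g * b), mul_le_mul_of_nonneg_right h1 (sq_nonneg a),
      mul_le_mul_of_nonneg_right h2 (sq_nonneg b), mul_nonneg (sq_nonneg N) (sq_nonneg a),
      mul_nonneg (sq_nonneg N) (sq_nonneg b)]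
  have h1 : X ^ 2 ≤ 2 * N ^ 2 * (a ^ 2 + b ^ 2) := hX ▸ hsq f g a b hf hg
  have h2 : Y ^ 2 ≤ 2 * N ^ 2 * (a ^ 2 + b ^ 2) := by
    rw [hY, add_comm (a ^ 2)]
    exact hsq s t b a hs ht
  have h3 : 0 ≤ m₁ / 2 * (u + 2 * γ * X) ^ 2 := by positivity
  have h4 : 0 ≤ m₂ / 2 * (v + 2 * γ * Y) ^ 2 := by positivity
  have hm0 : 0 ≤ m := hm₁.le.trans hm₁'
  have h5 : m₁ * (γ ^ 2 * X ^ 2) ≤ m * (γ ^ 2 * (2 * N ^ 2 * (a ^ 2 + b ^ 2))) := by gcongr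
  have h6 : m₂ * (γ ^ 2 * Y ^ 2) ≤ m * (γ ^ 2 * (2 * N ^ 2 * (a ^ 2 + b ^ 2))) := by gcongr
  nlinarith

/-- The amplitudes are confined to the disc and the potential is bounded there, so bounded energy
bounds the velocities; the cross term costs only part of the kinetic energy. -/
theorem IsDampedGradient.norm_lt_of_lyapunov_le
    (H : IsDampedGradient c₀ μ₀ K₀ K₁ m₁ m₂ F a₁ b₁ a₂ b₂) (hm₁ : 0 < m₁) (hm₂ : 0 < m₂)
    (hγ : 0 < γ) (hγ1 : γ ≤ 1) {m N P V₀ : ℝ} (hm₁' : m₁ ≤ m) (hm₂' : m₂ ≤ m) (hP : 0 ≤ P)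
    (hbd : ∀ x y, x ^ 2 + y ^ 2 ≤ P →
      |potential μ₀ K₀ K₁ x y| ≤ N ∧ |force μ₀ K₀ K₁ x y| ≤ N) {x : E}
    (hx : a₁ x ^ 2 + a₂ x ^ 2 ≤ P) (n4 : |V₀| ≤ N)
    (hWx : lyapunov μ₀ K₀ K₁ m₁ m₂ γ a₁ b₁ a₂ b₂ x ≤ V₀) :
    ‖x‖ < P + 4 / min m₁ m₂ * (2 * N + 2 * m * N ^ 2) + 1 := by
  set k := min m₁ m₂ with hk
  have hk0 : 0 < k := lt_min hm₁ hm₂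
  have hm0 : 0 < m := hm₁.trans_le hm₁'
  have hγsq : γ ^ 2 ≤ 1 := by nlinarith
  obtain ⟨n1, n2⟩ := hbd (a₁ x) (a₂ x) hx
  obtain ⟨-, n3⟩ := hbd (a₂ x) (a₁ x) (by linarith)
  rw [lyapunov] at hWx
  generalize potential μ₀ K₀ K₁ (a₁ x) (a₂ x) = V at *
  generalize force μ₀ K₀ K₁ (a₁ x) (a₂ x) = f₁ at *
  generalize force μ₀ K₀ K₁ (a₂ x) (a₁ x) = f₂ at *
  have h1 : f₁ ^ 2 ≤ N ^ 2 := sq_le_sq' (abs_le.1 n2).1 (abs_le.1 n2).2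
  have h2 : f₂ ^ 2 ≤ N ^ 2 := sq_le_sq' (abs_le.1 n3).1 (abs_le.1 n3).2
  have h3 : ∀ m' : ℝ, 0 < m' → k ≤ m' → m' ≤ m → ∀ b f : ℝ, f ^ 2 ≤ N ^ 2 →
      k / 4 * b ^ 2 - m * N ^ 2 ≤ m' / 2 * b ^ 2 + γ * (m' * (b * f)) := by
    intro m' hm'0 hkm' hm'm b f hf
    have e1 : 0 ≤ m' / 4 * (b + 2 * γ * f) ^ 2 := by positivity
    have e2 : m' * (γ ^ 2 * f ^ 2) ≤ m * (1 * N ^ 2) := by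
      gcongr
    have e3 : k / 4 * b ^ 2 ≤ m' / 4 * b ^ 2 := by gcongr
    nlinarith
  have h4 := h3 m₁ hm₁ (min_le_left _ _) hm₁' (b₁ x) f₁ h1
  have h5 := h3 m₂ hm₂ (min_le_right _ _) hm₂' (b₂ x) f₂ h2
  have h6 : k / 4 * (b₁ x ^ 2 + b₂ x ^ 2) ≤ 2 * N + 2 * m * N ^ 2 := by
    linarith [(abs_le.1 n1).1, (abs_le.1 n4).2]
  have h7 : b₁ x ^ 2 + b₂ x ^ 2 ≤ 4 / k * (2 * N + 2 * m * N ^ 2) := by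
    calc b₁ x ^ 2 + b₂ x ^ 2 = 4 / k * (k / 4 * (b₁ x ^ 2 + b₂ x ^ 2)) := by field_simp
      _ ≤ _ := by gcongr
  have h8 := H.norm_sq_le x
  have h9 : ‖x‖ ^ 2 ≤ P + 4 / k * (2 * N + 2 * m * N ^ 2) := by linarith
  nlinarith [sq_nonneg (‖x‖ - 1)]

/-- Adding this multiple of the squared radial component turns the Hessian of the potential into ΛP
times the identity, of which half pays for the cross term. -/
theorem IsDampedGradient.hessian_lower_bound
    (H : IsDampedGradient c₀ μ₀ K₀ K₁ m₁ m₂ F a₁ b₁ a₂ b₂) (hm₁ : 0 < m₁) (hm₂ : 0 < m₂)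
    (hp : IsPass μ₀ K₀ K₁ Λ (a₁ p) (a₂ p)) (hb1 : b₁ p = 0) (hb2 : b₂ p = 0) {m N : ℝ}
    (hm₁' : m₁ ≤ m) (hm₂' : m₂ ≤ m) (n1 : |μ₀ + 3 * K₀ * a₁ p ^ 2 + K₁ * a₂ p ^ 2| ≤ N)
    (n2 : |2 * K₁ * a₁ p * a₂ p| ≤ N) (n3 : |μ₀ + 3 * K₀ * a₂ p ^ 2 + K₁ * a₁ p ^ 2| ≤ N)
    (n4 : |2 * K₁ * a₂ p * a₁ p| ≤ N)
    (hγ : 8 * m * N ^ 2 * γ ^ 2 ≤ Λ * (a₁ p ^ 2 + a₂ p ^ 2) / 2) (w : E) :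
    min (min m₁ m₂ / 2) (Λ * (a₁ p ^ 2 + a₂ p ^ 2) / 2) * ‖w‖ ^ 2 ≤
      fderiv ℝ (fderiv ℝ (lyapunov μ₀ K₀ K₁ m₁ m₂ γ a₁ b₁ a₂ b₂)) p w w +
        (Λ + 2 * μ₀ / (a₁ p ^ 2 + a₂ p ^ 2)) * (a₁ p * a₁ w + a₂ p * a₂ w) ^ 2 := by
  have hP0 := hp.radius_pos
  have hΛ := hp.gap_pos
  rw [fderiv_fderiv_lyapunov hb1 hb2, hp.hessian]
  set P := a₁ p ^ 2 + a₂ p ^ 2 with hP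
  set k := min m₁ m₂ with hk
  have hk0 : 0 < k := lt_min hm₁ hm₂
  have h1 := transverse_estimate (γ := γ) hm₁ hm₂ hm₁' hm₂' (a := a₁ w) (b := a₂ w) rfl rfl
    n1 n2 n3 n4 (b₁ w) (b₂ w)
  have h2 := H.norm_sq_le w
  have h3 : 8 * m * N ^ 2 * γ ^ 2 * (a₁ w ^ 2 + a₂ w ^ 2) ≤
      Λ * P / 2 * (a₁ w ^ 2 + a₂ w ^ 2) := by gcongr
  have h4 : min (k / 2) (Λ * P / 2) * ‖w‖ ^ 2 ≤
      k / 2 * b₁ w ^ 2 + k / 2 * b₂ w ^ 2 + Λ * P / 2 * (a₁ w ^ 2 + a₂ w ^ 2) := by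
    calc min (k / 2) (Λ * P / 2) * ‖w‖ ^ 2 ≤ min (k / 2) (Λ * P / 2) *
          (a₁ w ^ 2 + b₁ w ^ 2 + a₂ w ^ 2 + b₂ w ^ 2) := by gcongr
      _ = min (k / 2) (Λ * P / 2) * b₁ w ^ 2 + min (k / 2) (Λ * P / 2) * b₂ w ^ 2 +
          min (k / 2) (Λ * P / 2) * (a₁ w ^ 2 + a₂ w ^ 2) := by ring
      _ ≤ _ := by
        gcongr
        · exact min_le_left _ _
        · exact min_le_left _ _
        · exact min_le_right _ _
  have h5 : k / 2 * b₁ w ^ 2 ≤ m₁ / 2 * b₁ w ^ 2 := by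
    gcongr
    exact min_le_left _ _
  have h6 : k / 2 * b₂ w ^ 2 ≤ m₂ / 2 * b₂ w ^ 2 := by
    gcongr
    exact min_le_right _ _
  linarith

/-- In a damped gradient system, a pass of the potential is a mountain pass of the flow. -/
theorem IsDampedGradient.exists_isMountainPass
    (H : IsDampedGradient c₀ μ₀ K₀ K₁ m₁ m₂ F a₁ b₁ a₂ b₂) (hc₀ : 0 < c₀) (hμ₀ : 0 < μ₀)
    (hm₁ : 0 < m₁) (hm₂ : 0 < m₂) (hp : IsPass μ₀ K₀ K₁ Λ (a₁ p) (a₂ p)) (hb1 : b₁ p = 0)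
    (hb2 : b₂ p = 0) : ∃ W h R, IsMountainPass F W h p R := by
  -- Doubling the squared radius leaves room around the closed region, as dissipation is also needed
  -- on a neighbourhood of the pass.
  obtain ⟨N, hN, hbd⟩ := exists_bounds μ₀ K₀ K₁ (2 * (a₁ p ^ 2 + a₂ p ^ 2))
  set P := a₁ p ^ 2 + a₂ p ^ 2 with hP
  have hP0 : 0 < P := hp.radius_pos
  have hΛ := hp.gap_pos
  set m := max m₁ m₂ with hm
  have hm₁' : m₁ ≤ m := le_max_left _ _
  have hm₂' : m₂ ≤ m := le_max_right _ _
  have hm0 : 0 < m := hm₁.trans_le hm₁'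
  -- The conditions on γ serve, in order, γ² ≤ γ, the dissipation, the boundary height and the
  -- Hessian at the pass. The last two are quadratic in γ and are made linear by the first.
  obtain ⟨γ, hγpos, hγ1, hγ2, hγ3, hγ4⟩ := ((eventually_mem_nhdsWithin (a := (0 : ℝ)) (s := Ioi 0)).and
    ((eventually_mul_lt 1 one_pos).and
    ((eventually_mul_lt (2 * m * N + c₀ ^ 2 / 2) (half_pos hc₀)).and
    ((eventually_mul_lt (m * (P * Λ)) one_pos).and
    (eventually_mul_lt (8 * m * N ^ 2) (half_pos (mul_pos hΛ hP0))))))).exists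
  have hγ : 0 < γ := hγpos
  have hγsq : γ ^ 2 ≤ γ := by nlinarith
  have hγ3' : m * (P * Λ) * γ ^ 2 ≤ 1 := by
    have : m * (P * Λ) * γ ^ 2 ≤ m * (P * Λ) * γ := by gcongr
    linarith
  have hγ4' : 8 * m * N ^ 2 * γ ^ 2 ≤ Λ * P / 2 := by
    have : 8 * m * N ^ 2 * γ ^ 2 ≤ 8 * m * N ^ 2 * γ := by gcongr
    linarith
  set k := min m₁ m₂ with hk
  have hk0 : 0 < k := lt_min hm₁ hm₂
  have hWp := lyapunov_of_equilibrium (μ₀ := μ₀) (K₀ := K₀) (K₁ := K₁) (m₁ := m₁) (m₂ := m₂)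
    (γ := γ) (a₁ := a₁) (a₂ := a₂) hb1 hb2
  obtain ⟨c, hc, hdis⟩ := H.dissipation (γ := γ) hc₀ hm₁ hm₂ hγ hm₁' hm₂' hN
    (fun x y hxy ↦ (hbd x y hxy).2.2) hγ2.le
  have hfd : ∀ w, fderiv ℝ (fun x ↦ a₁ x ^ 2 + a₂ x ^ 2 - P) p w =
      2 * (a₁ p * a₁ w + a₂ p * a₂ w) := by
    intro w
    refine fderiv_apply_of_line (by fun_prop) ?_
    have h := (((hasDerivAt_line a₁ p w 0).pow 2).add ((hasDerivAt_line a₂ p w 0).pow 2)).sub_const P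
    convert! h using 1
    simp only [zero_smul, add_zero]
    ring
  refine ⟨lyapunov μ₀ K₀ K₁ m₁ m₂ γ a₁ b₁ a₂ b₂, fun x ↦ a₁ x ^ 2 + a₂ x ^ 2 - P,
    P + 4 / k * (2 * N + 2 * m * N ^ 2) + 1, ?_⟩
  refine
    { contDiff_field := H.contDiff
      contDiff_lyapunov := contDiff_lyapunov
      contDiff_boundary := by fun_prop
      norm_lt := ?_
      dissipation := ⟨c, hc, P, hP0, fun x hx ↦ hdis x (by linarith)⟩
      le_on_boundary := fun x hx ↦ lyapunov_le_on_circle hm₁ hm₂ hp hb1 hb2 hm₁' hm₂' hγ3'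
        (by linarith)
      eq_zero_of_inside := ?_
      map_zero := H.map_eq_zero hc₀ hm₁ hm₂ (by simp) (by simp) (by simp [force])
        (by simp [force])
      map_pass := H.map_eq_zero hc₀ hm₁ hm₂ hb1 hb2 hp.force_fst hp.force_snd
      zero_inside := by simpa using hP0
      pass_on_boundary := by simp [hP]
      zero_lt_pass := ?_
      injective_zero := H.injective_fderiv (by simp [hμ₀.ne'])
      injective_pass := H.injective_fderiv hp.nondegenerate
      critical_zero := by
        ext v
        rw [fderiv_lyapunov]
        simp [force]
      critical_pass := by
        ext v
        rw [fderiv_lyapunov, hb1, hb2, hp.force_fst, hp.force_snd]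
        simp
      descending := ⟨p, ?_⟩
      transverse := ⟨min (k / 2) (Λ * P / 2), by positivity, (Λ + 2 * μ₀ / P) / 4, by positivity,
        fun w ↦ ?_⟩ }
  · intro x hx hWx
    rw [hWp] at hWx
    exact H.norm_lt_of_lyapunov_le hm₁ hm₂ hγ (by linarith) hm₁' hm₂' hP0.le
      (fun x y hxy ↦ (hbd x y (by linarith)).imp id And.left)
      (by linarith) ((hbd _ _ (by linarith)).1) hWx
  · intro x hx hFx
    obtain ⟨h1, h2, h3, h4⟩ := H.eq_zero_of_map_eq_zero hFx
    obtain ⟨h5, h6⟩ := hp.inside _ _ (by linarith) h3 h4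
    have h7 := H.norm_sq_le x
    rw [h1, h2, h5, h6] at h7
    refine norm_le_zero_iff.1 ?_
    nlinarith [norm_nonneg x]
  · rw [hWp]
    simpa [lyapunov, potential, force] using hp.height_pos
  -- The vector `p` itself is the radial direction with zero velocities, so only the eigenvalue -2μ₀
  -- is seen.
  · rw [fderiv_fderiv_lyapunov hb1 hb2, hp.hessian, hb1, hb2]
    have : Λ * P * P - (Λ + 2 * μ₀ / P) * (a₁ p * a₁ p + a₂ p * a₂ p) ^ 2 = -(2 * μ₀ * P) := by
      rw [show a₁ p * a₁ p + a₂ p * a₂ p = P by rw [hP]; ring]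
      field_simp
      ring
    have hpos : 0 < 2 * μ₀ * P := by positivity
    linarith
  · obtain ⟨-, -, n1, n2⟩ := hbd (a₁ p) (a₂ p) (by linarith)
    obtain ⟨-, -, n3, n4⟩ := hbd (a₂ p) (a₁ p) (by linarith)
    rw [hfd]
    have h1 := H.hessian_lower_bound (γ := γ) hm₁ hm₂ hp hb1 hb2 hm₁' hm₂' n1 n2 n3 n4 hγ4' w
    have h7 : (Λ + 2 * μ₀ / P) / 4 * (2 * (a₁ p * a₁ w + a₂ p * a₂ w)) ^ 2 =
        (Λ + 2 * μ₀ / P) * (a₁ p * a₁ w + a₂ p * a₂ w) ^ 2 := by ring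
    rw [h7]
    exact h1

end DampedGradient

/-! ### Application to the reduced system and the slow subsystem. -/

/-- Patterns of a damped gradient system with forcing terms `r` are connected to the trivial
state. -/
theorem connectsToTrivial_of_isDampedGradient {E : Type*} [NormedAddCommGroup E]
    [NormedSpace ℝ E] [FiniteDimensional ℝ E] {c₀ μ₀ K₀ K₁ m₁ m₂ : ℝ}
    {F : (E → ℝ × ℝ) → E → E} {embed : ℝ × ℝ → E} {sym : (E → ℝ × ℝ) → Prop}
    {a₁ b₁ a₂ b₂ : E →L[ℝ] ℝ} (hc₀ : 0 < c₀) (hm₁ : 0 < m₁) (hm₂ : 0 < m₂) (hK₀ : K₀ < 0)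
    (hμ₀ : 0 < μ₀) (hembed₀ : embed 0 = 0) (hembed : ∀ A A', ‖embed A' - embed A‖ = ‖A' - A‖)
    (H : IsDampedGradient c₀ μ₀ K₀ K₁ m₁ m₂ (F 0) a₁ b₁ a₂ b₂)
    (ha₁ : ∀ A, a₁ (embed A) = A.1) (hb₁ : ∀ A, b₁ (embed A) = 0)
    (ha₂ : ∀ A, a₂ (embed A) = A.2) (hb₂ : ∀ A, b₂ (embed A) = 0)
    (T : ℝ × ℝ →L[ℝ] E) (hF : ∀ r x, F r x = F 0 x + T (r x))
    (hzero : ∀ r x, F r x = 0 → ∃ A, x = embed A)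
    (heq : ∀ r A, F r (embed A) = 0 ↔ force μ₀ K₀ K₁ A.1 A.2 + (r (embed A)).1 = 0 ∧
      force μ₀ K₀ K₁ A.2 A.1 + (r (embed A)).2 = 0)
    (hneg₁ : ∀ r, sym r → ∀ x y, r (embed (-x, y)) = (-(r (embed (x, y))).1, (r (embed (x, y))).2))
    (hneg₂ : ∀ r, sym r → ∀ x y, r (embed (x, -y)) = ((r (embed (x, y))).1, -(r (embed (x, y))).2))
    (hswap : ∀ r, sym r → ∀ A : ℝ × ℝ, r (embed A.swap) = (r (embed A)).swap) :
    (K₁ < K₀ → ∀ A ∈ squares μ₀ K₀ K₁, ConnectsToTrivial F embed sym IsSquareShape A) ∧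
      (K₀ < K₁ → ∀ A ∈ rolls μ₀ K₀, ConnectsToTrivial F embed sym IsRollShape A) := by
  have hpass : ∀ {Λ : ℝ} {A : ℝ × ℝ}, IsPass μ₀ K₀ K₁ Λ A.1 A.2 →
      ∃ W h R, IsMountainPass (F 0) W h (embed A) R := fun {Λ A} hA ↦
    H.exists_isMountainPass hc₀ hμ₀ hm₁ hm₂ (by rwa [ha₁, ha₂]) (hb₁ A) (hb₂ A)
  constructor
  · intro hK A hA
    have hp := isPass_of_mem_squares hK₀ hK hμ₀ hA
    obtain ⟨W, h, R, hMP⟩ := hpass hp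
    obtain ⟨x₀, y₀⟩ := A
    have habs : |x₀| = |y₀| := hA.1.trans hA.2.symm
    have hx₀ : x₀ ≠ 0 := by
      rintro rfl
      have hy₀ : y₀ = 0 := by simpa using habs.symm
      have := hp.radius_pos
      simp [hy₀] at this
    -- A square lies on one of the two diagonals, and `S` is the reflection in that diagonal: the
    -- exchange, or the exchange combined with both sign changes.
    rcases abs_eq_abs.1 habs with he | he
    · refine connectsToTrivial_of_isMountainPass hembed₀ hembed T hF hzero hMP Prod.swap
        (fun A' ↦ ?_) (fun r hr A' hA' ↦ ?_) (fun A' hA' h0 ↦ ?_) hx₀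
      · subst he
        simp [Prod.norm_def, max_comm]
      · rw [heq] at hA' ⊢
        rw [hswap r hr]
        exact ⟨hA'.2, hA'.1⟩
      · obtain ⟨x, y⟩ := A'
        have : y = x := congrArg Prod.fst hA'
        exact ⟨by rw [this], h0⟩
    · refine connectsToTrivial_of_isMountainPass hembed₀ hembed T hF hzero hMP
        (fun A' ↦ (-A'.2, -A'.1)) (fun A' ↦ ?_) (fun r hr A' hA' ↦ ?_) (fun A' hA' h0 ↦ ?_) hx₀
      · subst he
        have h1 : ((-A'.2, -A'.1) : ℝ × ℝ) - (-y₀, y₀) = -(A' - (-y₀, y₀)).swap := by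
          ext <;> simp <;> ring
        rw [h1, norm_neg]
        simp [Prod.norm_def, max_comm]
      · rw [heq] at hA' ⊢
        have h1 := hswap r hr A'
        rw [Prod.swap] at h1
        rw [hneg₁ r hr, hneg₂ r hr, h1]
        have h2 : ∀ x y, force μ₀ K₀ K₁ (-x) (-y) = -force μ₀ K₀ K₁ x y := fun x y ↦ by
          rw [force, force]; ring
        simp only [h2, Prod.fst_swap, Prod.snd_swap]
        constructor
        · linarith [hA'.2]
        · linarith [hA'.1]
      · obtain ⟨x, y⟩ := A'
        have : -y = x := congrArg Prod.fst hA'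
        exact ⟨by rw [← this, abs_neg], h0⟩
  · intro hK A hA
    have hp := isPass_of_mem_rolls hK₀ hK hμ₀ hA
    obtain ⟨W, h, R, hMP⟩ := hpass hp
    obtain ⟨x₀, y₀⟩ := A
    have hy₀ : y₀ = 0 := hA.2
    have hx₀ : x₀ ≠ 0 := by
      rintro rfl
      have := hp.radius_pos
      simp [hy₀] at this
    subst hy₀
    -- A roll lies on the first axis, so `S` is the reflection in that axis.
    refine connectsToTrivial_of_isMountainPass hembed₀ hembed T hF hzero hMP
      (fun A' ↦ (A'.1, -A'.2)) (fun A' ↦ ?_) (fun r hr A' hA' ↦ ?_) (fun A' hA' h0 ↦ ?_) hx₀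
    · simp [Prod.norm_def]
    · rw [heq] at hA' ⊢
      rw [hneg₂ r hr]
      have h1 : force μ₀ K₀ K₁ A'.1 (-A'.2) = force μ₀ K₀ K₁ A'.1 A'.2 := by
        rw [force, force]; ring
      have h2 : force μ₀ K₀ K₁ (-A'.2) A'.1 = -force μ₀ K₀ K₁ A'.2 A'.1 := by
        rw [force, force]; ring
      simp only [h1, h2]
      refine ⟨hA'.1, ?_⟩
      linarith [hA'.2]
    · obtain ⟨x, y⟩ := A'
      have : -y = y := congrArg Prod.snd hA'
      exact ⟨h0, by simp only; linarith⟩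

/-- The masses are 4cos²θ and 4sin²θ, both positive for 0 < θ < π/4, so both modes are inertial. -/
theorem connectsToTrivial_reducedField {θ c₀ μ₀ K₀ K₁ : ℝ} (hθ : θ ∈ Ico 0 (Real.pi / 4))
    (hθ₀ : θ ≠ 0) (hc₀ : 0 < c₀) (hK₀ : K₀ < 0) (hμ₀ : 0 < μ₀) :
    (K₁ < K₀ → ∀ A ∈ squares μ₀ K₀ K₁, ConnectsToTrivial (reducedField θ c₀ μ₀ K₀ K₁) embed4
      IsLatticeSymmetric4 IsSquareShape A) ∧
    (K₀ < K₁ → ∀ A ∈ rolls μ₀ K₀, ConnectsToTrivial (reducedField θ c₀ μ₀ K₀ K₁) embed4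
      IsLatticeSymmetric4 IsRollShape A) := by
  have hθpos : 0 < θ := lt_of_le_of_ne hθ.1 (Ne.symm hθ₀)
  have hpi := Real.pi_pos
  have hm₁ : 0 < 4 * (inner ℝ (dir θ) k₁) ^ 2 := by
    have h : inner ℝ (dir θ) k₁ = Real.cos θ := by
      simp [dir, k₁, PiLp.inner_apply, Fin.sum_univ_two]
    rw [h]
    have := Real.cos_pos_of_mem_Ioo (x := θ) ⟨by linarith, by linarith [hθ.2]⟩
    positivity
  have hm₂ : 0 < 4 * (inner ℝ (dir θ) k₂) ^ 2 := by
    have h : inner ℝ (dir θ) k₂ = Real.sin θ := by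
      simp [dir, k₂, PiLp.inner_apply, Fin.sum_univ_two]
    rw [h]
    have := Real.sin_pos_of_pos_of_lt_pi hθpos (by linarith [hθ.2])
    positivity
  have hfield : ∀ (r : Phase4 → ℝ × ℝ) (x : Phase4), reducedField θ c₀ μ₀ K₀ K₁ r x =
      (x.2.1, -(force μ₀ K₀ K₁ x.1 x.2.2.1 + c₀ * x.2.1 + (r x).1) /
          (4 * (inner ℝ (dir θ) k₁) ^ 2),
        x.2.2.2, -(force μ₀ K₀ K₁ x.2.2.1 x.1 + c₀ * x.2.2.2 + (r x).2) /
          (4 * (inner ℝ (dir θ) k₂) ^ 2)) := by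
    intro r x
    simp only [reducedField, force, sq_abs, Prod.mk.injEq, true_and]
    constructor <;> ring
  generalize hg₁ : 4 * (inner ℝ (dir θ) k₁) ^ 2 = m₁ at *
  generalize hg₂ : 4 * (inner ℝ (dir θ) k₂) ^ 2 = m₂ at *
  let fst : Phase4 →L[ℝ] ℝ := ContinuousLinearMap.fst ℝ ℝ (ℝ × ℝ × ℝ)
  let tail : Phase4 →L[ℝ] ℝ × ℝ × ℝ := ContinuousLinearMap.snd ℝ ℝ (ℝ × ℝ × ℝ)
  let tail₂ : Phase4 →L[ℝ] ℝ × ℝ := (ContinuousLinearMap.snd ℝ ℝ (ℝ × ℝ)).comp tail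
  refine connectsToTrivial_of_isDampedGradient (m₁ := m₁) (m₂ := m₂)
    (a₁ := fst) (b₁ := (ContinuousLinearMap.fst ℝ ℝ (ℝ × ℝ)).comp tail)
    (a₂ := (ContinuousLinearMap.fst ℝ ℝ ℝ).comp tail₂)
    (b₂ := (ContinuousLinearMap.snd ℝ ℝ ℝ).comp tail₂)
    hc₀ hm₁ hm₂ hK₀ hμ₀ rfl (fun A A' ↦ by simp [embed4, Prod.norm_def]) ?_
    (fun A ↦ rfl) (fun A ↦ rfl) (fun A ↦ rfl) (fun A ↦ rfl)
    ((0 : ℝ × ℝ →L[ℝ] ℝ).prod (((-m₁⁻¹) • ContinuousLinearMap.fst ℝ ℝ ℝ).prod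
      ((0 : ℝ × ℝ →L[ℝ] ℝ).prod ((-m₂⁻¹) • ContinuousLinearMap.snd ℝ ℝ ℝ)))) ?_ ?_ ?_
    (fun r hr x y ↦ ?_) (fun r hr x y ↦ ?_) (fun r hr A ↦ hr.exchange A)
  · constructor
    · have : reducedField θ c₀ μ₀ K₀ K₁ 0 = _ := funext (hfield 0)
      rw [this]
      unfold force
      simp only [Pi.zero_apply]
      fun_prop
    · intro x
      have h : ‖x‖ ≤ Real.sqrt (x.1 ^ 2 + x.2.1 ^ 2 + x.2.2.1 ^ 2 + x.2.2.2 ^ 2) := by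
        simp only [Prod.norm_def, Real.norm_eq_abs]
        refine max_le ?_ (max_le ?_ (max_le ?_ ?_)) <;> refine Real.abs_le_sqrt ?_ <;>
          nlinarith [sq_nonneg x.1, sq_nonneg x.2.1, sq_nonneg x.2.2.1, sq_nonneg x.2.2.2]
      calc ‖x‖ ^ 2 ≤ Real.sqrt (x.1 ^ 2 + x.2.1 ^ 2 + x.2.2.1 ^ 2 + x.2.2.2 ^ 2) ^ 2 := by gcongr
        _ = _ := Real.sq_sqrt (by positivity)
    · intro x
      rw [hfield]
      rfl
    · intro x
      rw [hfield]
      change m₁ * (-(force μ₀ K₀ K₁ x.1 x.2.2.1 + c₀ * x.2.1 + 0) / m₁) =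
        -(force μ₀ K₀ K₁ x.1 x.2.2.1 + c₀ * x.2.1)
      field_simp
      ring
    · left
      intro x
      rw [hfield]
      rfl
    · intro x
      rw [hfield]
      change m₂ * (-(force μ₀ K₀ K₁ x.2.2.1 x.1 + c₀ * x.2.2.2 + 0) / m₂) =
        -(force μ₀ K₀ K₁ x.2.2.1 x.1 + c₀ * x.2.2.2)
      field_simp
      ring
  · intro r x
    rw [hfield, hfield]
    ext <;> simp <;> field_simp <;> ring
  · intro r x hx
    rw [hfield] at hx
    simp only [Prod.mk_eq_zero] at hx
    refine ⟨(x.1, x.2.2.1), ?_⟩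
    rw [embed4]
    ext
    · rfl
    · exact hx.1
    · rfl
    · exact hx.2.2.1
  · intro r A
    rw [hfield]
    simp only [embed4, mul_zero, add_zero, Prod.mk_eq_zero, div_eq_zero_iff, hm₁.ne', hm₂.ne',
      or_false, neg_eq_zero, true_and]
  · have := hr.neg_fst x 0 y 0
    rwa [neg_zero] at this
  · have := hr.neg_snd x 0 y 0
    rwa [neg_zero] at this

theorem connectsToTrivial_slowField {c₀ μ₀ K₀ K₁ : ℝ} (hc₀ : 0 < c₀) (hK₀ : K₀ < 0)
    (hμ₀ : 0 < μ₀) :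
    (K₁ < K₀ → ∀ A ∈ squares μ₀ K₀ K₁, ConnectsToTrivial (slowField c₀ μ₀ K₀ K₁) embed3
      IsLatticeSymmetric3 IsSquareShape A) ∧
    (K₀ < K₁ → ∀ A ∈ rolls μ₀ K₀, ConnectsToTrivial (slowField c₀ μ₀ K₀ K₁) embed3
      IsLatticeSymmetric3 IsRollShape A) := by
  have hfield : ∀ (r : Phase3 → ℝ × ℝ) (x : Phase3), slowField c₀ μ₀ K₀ K₁ r x =
      (x.2.1, -(force μ₀ K₀ K₁ x.1 x.2.2 + c₀ * x.2.1 + (r x).1) / 4,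
        -(force μ₀ K₀ K₁ x.2.2 x.1 + (r x).2) / c₀) := by
    intro r x
    simp only [slowField, force, sq_abs, Prod.mk.injEq, true_and]
    constructor <;> ring
  let fst : Phase3 →L[ℝ] ℝ := ContinuousLinearMap.fst ℝ ℝ (ℝ × ℝ)
  let tail : Phase3 →L[ℝ] ℝ × ℝ := ContinuousLinearMap.snd ℝ ℝ (ℝ × ℝ)
  -- The second mode is overdamped: its velocity functional is 0, so m₂ multiplies nothing and any
  -- positive value would do.
  refine connectsToTrivial_of_isDampedGradient (m₁ := 4) (m₂ := 4)
    (a₁ := fst) (b₁ := (ContinuousLinearMap.fst ℝ ℝ ℝ).comp tail)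
    (a₂ := (ContinuousLinearMap.snd ℝ ℝ ℝ).comp tail) (b₂ := 0)
    hc₀ (by norm_num) (by norm_num) hK₀ hμ₀ rfl (fun A A' ↦ by simp [embed3, Prod.norm_def]) ?_
    (fun A ↦ rfl) (fun A ↦ rfl) (fun A ↦ rfl) (fun A ↦ rfl)
    ((0 : ℝ × ℝ →L[ℝ] ℝ).prod (((-(4 : ℝ)⁻¹) • ContinuousLinearMap.fst ℝ ℝ ℝ).prod
      ((-c₀⁻¹) • ContinuousLinearMap.snd ℝ ℝ ℝ))) ?_ ?_ ?_
    (fun r hr x y ↦ ?_) (fun r hr x y ↦ ?_) (fun r hr A ↦ hr.exchange A)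
  · constructor
    · have : slowField c₀ μ₀ K₀ K₁ 0 = _ := funext (hfield 0)
      rw [this]
      unfold force
      simp only [Pi.zero_apply]
      fun_prop
    · intro x
      have h : ‖x‖ ≤ Real.sqrt (x.1 ^ 2 + x.2.1 ^ 2 + x.2.2 ^ 2) := by
        simp only [Prod.norm_def, Real.norm_eq_abs]
        refine max_le ?_ (max_le ?_ ?_) <;> refine Real.abs_le_sqrt ?_ <;>
          nlinarith [sq_nonneg x.1, sq_nonneg x.2.1, sq_nonneg x.2.2]
      calc ‖x‖ ^ 2 ≤ Real.sqrt (x.1 ^ 2 + x.2.1 ^ 2 + x.2.2 ^ 2) ^ 2 := by gcongr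
        _ = x.1 ^ 2 + x.2.1 ^ 2 + x.2.2 ^ 2 := Real.sq_sqrt (by positivity)
        _ = x.1 ^ 2 + x.2.1 ^ 2 + x.2.2 ^ 2 + 0 ^ 2 := by ring
    · intro x
      rw [hfield]
      rfl
    · intro x
      rw [hfield]
      change 4 * (-(force μ₀ K₀ K₁ x.1 x.2.2 + c₀ * x.2.1 + 0) / 4) =
        -(force μ₀ K₀ K₁ x.1 x.2.2 + c₀ * x.2.1)
      ring
    · exact Or.inr fun x ↦ rfl
    · intro x
      rw [hfield]
      change 4 * (0 : ℝ) = -(force μ₀ K₀ K₁ x.2.2 x.1 +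
        c₀ * (-(force μ₀ K₀ K₁ x.2.2 x.1 + 0) / c₀))
      field_simp
      ring
  · intro r x
    rw [hfield, hfield]
    ext <;> simp <;> field_simp <;> ring
  · intro r x hx
    rw [hfield] at hx
    simp only [Prod.mk_eq_zero] at hx
    refine ⟨(x.1, x.2.2), ?_⟩
    rw [embed3]
    ext
    · rfl
    · exact hx.1
    · rfl
  · intro r A
    rw [hfield]
    simp only [embed3, mul_zero, add_zero, Prod.mk_eq_zero, div_eq_zero_iff, hc₀.ne',
      four_ne_zero, or_false, neg_eq_zero, true_and]
  · have := hr.neg_fst x 0 y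
    rwa [neg_zero] at this
  · exact hr.neg_snd x 0 y

end SquareLattice

theorem mainTheorem10 (θ c₀ K₀ K₁ : ℝ) (hθ : θ ∈ Set.Ico 0 (Real.pi / 4))
    (hc₀ : 0 < c₀) (hK₀ : K₀ < 0) :
    (K₁ < K₀ → ∀ μ₀ : ℝ, 0 < μ₀ → ∀ A ∈ SquareLattice.squares μ₀ K₀ K₁,
      (θ ≠ 0 → SquareLattice.ConnectsToTrivial
        (SquareLattice.reducedField θ c₀ μ₀ K₀ K₁) SquareLattice.embed4
        SquareLattice.IsLatticeSymmetric4 SquareLattice.IsSquareShape A) ∧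
      SquareLattice.ConnectsToTrivial
        (SquareLattice.slowField c₀ μ₀ K₀ K₁) SquareLattice.embed3
        SquareLattice.IsLatticeSymmetric3 SquareLattice.IsSquareShape A) ∧
    (K₀ < K₁ → K₁ < 0 → ∀ μ₀ : ℝ, 0 < μ₀ → ∀ A ∈ SquareLattice.rolls μ₀ K₀,
      (θ ≠ 0 → SquareLattice.ConnectsToTrivial
        (SquareLattice.reducedField θ c₀ μ₀ K₀ K₁) SquareLattice.embed4
        SquareLattice.IsLatticeSymmetric4 SquareLattice.IsRollShape A) ∧
      SquareLattice.ConnectsToTrivial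
        (SquareLattice.slowField c₀ μ₀ K₀ K₁) SquareLattice.embed3
        SquareLattice.IsLatticeSymmetric3 SquareLattice.IsRollShape A) := by
  refine ⟨fun hK μ₀ hμ₀ A hA ↦ ⟨fun hθ₀ ↦ ?_, ?_⟩, fun hK _ μ₀ hμ₀ A hA ↦ ⟨fun hθ₀ ↦ ?_, ?_⟩⟩
  · exact (SquareLattice.connectsToTrivial_reducedField hθ hθ₀ hc₀ hK₀ hμ₀).1 hK A hA
  · exact (SquareLattice.connectsToTrivial_slowField hc₀ hK₀ hμ₀).1 hK A hA
  · exact (SquareLattice.connectsToTrivial_reducedField hθ hθ₀ hc₀ hK₀ hμ₀).2 hK A hA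
  · exact (SquareLattice.connectsToTrivial_slowField hc₀ hK₀ hμ₀).2 hK A hA
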